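/- **Games.** Let $k,n\ge 1$. A $k$-player normal form game $G$ with $n$ pure strategies per player assigns to every player $i\in[k]$ and every pure strategy profile $s\in[n]^k$ a rational payoff $M^i(s)\in[0,1]$. A mixed strategy profile $p=(p^1,\dots,p^k)$ consists of probability distributions on $[n]$; the expected payoff of player $i$ for the pure strategy $j$ is $u^i[j]=\sum_{s:\,s_i=j}M^i(s)\prod_{i'\neq i}p^{i'}_{s_{i'}}$. The profile $p$ is an $\epsilon$-well-supported Nash equilibrium of $G$ if $p^i_j>0$ implies $u^i[j]\ge u^i[j']-\epsilon$ for all $i,j,j'$. **Direct reductions.** A mapping from a $k$-player game $G$ with $n$ strategies per player to a 2-player game $G_2$ with $n_2$ strategies per player consists of a function $g:[k]\to[2]$ and injective functions $h_i:[n]\to[n_2]$, $i\in[k]$. It is a direct reduction from $(G,\epsilon)$ to $(G_2,\epsilon_2)$ if for every $\epsilon_2$-well-supported Nash equilibrium $(q^1,q^2)$ of $G_2$, the numbers $z_i=\sum_j q^{g(i)}[h_i(j)]$ are non-zero and $p^i[j]=\frac1{z_i}\,q^{g(i)}[h_i(j)]$ defines an $\epsilon$-well-supported Nash equilibrium of $G$.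 **Polynomial-time reductions.** Let $e,e':\mathbb N\to\mathbb R$. A direct, polynomial-time reduction from $e(n)$-$k$NASH to $e'(n)$-$2$NASH is an algorithm that, given (for arbitrary $k,n\ge1$) a $k$-player game $G$ with $n$ strategies per player, listed by all its payoffs as fractions of integers in binary, outputs a 2-player game $G_2$ with some number $n_2$ of strategies per player, listed in the same way, together with a mapping from $G$ to $G_2$ that is a direct reduction from $(G,e(n))$ to $(G_2,e'(n_2))$, and whose running time (on a random access machine with logarithmic cost) is at most a polynomial in the bit length of the input. **Corollary 2.** 1. ($1/\exp(n)$.) Let $p$ be a polynomial with coefficients in $\mathbb N$ and let $e(n)\ge 2^{-p(n)}$ for all $n\ge1$. Then there is a polynomial $q$ with coefficients in $\mathbb N$, of degree at most $\max\{1,\deg p\}$, such that there is a direct, polynomial-time reduction from $e(n)$-$k$NASH to $2^{-q(n)}$-$2$NASH. 2. ($1/\mathrm{poly}(n)$.) Let $p$ be a polynomial with coefficients in $\mathbb N$, $p(n)>0$ and $e(n)\ge 1/p(n)$ for all $n\ge1$. Then there is a polynomial $q$ with coefficients in $\mathbb N$, $q(n)>0$ for all $n\ge1$, such that there is a direct,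 polynomial-time reduction from $e(n)$-$k$NASH to $(1/q(n))$-$2$NASH. -/

import Mathlib

open scoped BigOperators

/-! ### Normal form games and well-supported approximate equilibria -/

/-- A normal form game with `k` players and `n` pure strategies for each of them; the payoffs are
rationals in `[0, 1]`.  `payoff i s` is what player `i` receives under the pure strategy profile
`s`, i.e. for playing `s i` against the other entries of `s`. -/
structure NormalFormGame (k n : ℕ) where
  payoff : Fin k → (Fin k → Fin n) → ℚ
  payoff_nonneg : ∀ i s, 0 ≤ payoff i s
  payoff_le_one : ∀ i s, payoff i s ≤ 1

/-- Every player's weights form a probability distribution on the pure strategies. -/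
def IsMixedProfile {k n : ℕ} (p : Fin k → Fin n → ℝ) : Prop :=
  ∀ i, (∀ j, 0 ≤ p i j) ∧ ∑ j, p i j = 1

namespace NormalFormGame

/-- Expected payoff of player `i` for the pure strategy `j` while the others play `p`. -/
noncomputable def expectedPayoff {k n : ℕ} (G : NormalFormGame k n) (p : Fin k → Fin n → ℝ)
    (i : Fin k) (j : Fin n) : ℝ :=
  ∑ s : Fin k → Fin n with s i = j,
    (G.payoff i s : ℝ) * ∏ i' ∈ Finset.univ.erase i, p i' (s i')

/-- `p` is an `ε`-well-supported Nash equilibrium: a mixed strategy profile whose supports contain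
only `ε`-best responses. -/
def IsWellSupportedNash {k n : ℕ} (G : NormalFormGame k n) (ε : ℝ) (p : Fin k → Fin n → ℝ) :
    Prop :=
  IsMixedProfile p ∧
    ∀ i j, 0 < p i j → ∀ j', G.expectedPayoff p i j' ≤ G.expectedPayoff p i j + ε

end NormalFormGame

/-! ### Mappings between games and direct reductions -/

/-- A mapping from a game with `k₁` players and `n₁` pure strategies each to a game with `k₂`
players and `n₂` pure strategies each. -/
structure GameMapping (k₁ n₁ k₂ n₂ : ℕ) where
  player : Fin k₁ → Fin k₂
  strategy : Fin k₁ → Fin n₁ → Fin n₂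
  strategy_injective : ∀ i, Function.Injective (strategy i)

/-- The weights `p i j = (1 / z i) * q (g i) (h i j)`, with `z i` the sum over `j` of the weights
`q (g i) (h i j)`.  If `z i = 0`, then `p i` is zero and so is not a mixed strategy. -/
noncomputable def GameMapping.renormalize {k₁ n₁ k₂ n₂ : ℕ} (μ : GameMapping k₁ n₁ k₂ n₂)
    (q : Fin k₂ → Fin n₂ → ℝ) : Fin k₁ → Fin n₁ → ℝ :=
  fun i j => q (μ.player i) (μ.strategy i j) / ∑ j', q (μ.player i) (μ.strategy i j')

/-- The mapping `μ` is a direct reduction from `(G₁, ε₁)` to `(G₂, ε₂)`. -/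
def IsDirectReduction {k₁ n₁ k₂ n₂ : ℕ} (G₁ : NormalFormGame k₁ n₁) (ε₁ : ℝ)
    (G₂ : NormalFormGame k₂ n₂) (ε₂ : ℝ) (μ : GameMapping k₁ n₁ k₂ n₂) : Prop :=
  ∀ q, G₂.IsWellSupportedNash ε₂ q → G₁.IsWellSupportedNash ε₁ (μ.renormalize q)

/-! ### The machine model: a random access machine with logarithmic cost

The memory consists of arrays of natural numbers, of which a program can name finitely many.
Every operation is charged the bit lengths of its operands, and a memory access is charged the bit
lengths of the address and of the content. -/

namespace RAM

/-- Content of the memory: array name, index, value. -/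
abbrev Mem := ℕ → ℕ → ℕ

/-- Expressions; subtraction is truncated, division rounds down and `x / 0 = 0`. -/
inductive Expr where
  | lit (c : ℕ)
  | get (a : ℕ) (e : Expr)
  | add (e f : Expr)
  | sub (e f : Expr)
  | mul (e f : Expr)
  | div (e f : Expr)

/-- Value of an expression. -/
def Expr.eval (m : Mem) : Expr → ℕ
  | lit c => c
  | get a e => m a (e.eval m)
  | add e f => e.eval m + f.eval m
  | sub e f => e.eval m - f.eval m
  | mul e f => e.eval m * f.eval m
  | div e f => e.eval m / f.eval m

/-- Time to evaluate an expression; `Nat.size` is the bit length. -/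
def Expr.cost (m : Mem) : Expr → ℕ
  | lit c => c.size + 1
  | get a e => e.cost m + (e.eval m).size + (m a (e.eval m)).size + 1
  | add e f => e.cost m + f.cost m + (e.eval m).size + (f.eval m).size + 1
  | sub e f => e.cost m + f.cost m + (e.eval m).size + (f.eval m).size + 1
  | mul e f => e.cost m + f.cost m + (e.eval m).size + (f.eval m).size + 1
  | div e f => e.cost m + f.cost m + (e.eval m).size + (f.eval m).size + 1

/-- Programs.  A condition holds if its value is not `0`. -/
inductive Prog where
  | skip
  | set (a : ℕ) (e f : Expr)
  | seq (c d : Prog)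
  | ite (e : Expr) (c d : Prog)
  | loop (e : Expr) (c : Prog)

/-- Write the value `v` into cell `i` of array `a`. -/
def Mem.write (m : Mem) (a i v : ℕ) : Mem :=
  Function.update m a (Function.update (m a) i v)

/-- `Exec c m m' t`: started on the memory `m`, the program `c` halts after time `t` with the
memory `m'`. -/
inductive Exec : Prog → Mem → Mem → ℕ → Prop where
  | skip (m : Mem) : Exec .skip m m 1
  | set (a : ℕ) (e f : Expr) (m : Mem) :
      Exec (.set a e f) m (Mem.write m a (e.eval m) (f.eval m))
        (e.cost m + f.cost m + (e.eval m).size + (f.eval m).size + 1)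
  | seq {c d : Prog} {m m' m'' : Mem} {t t' : ℕ} :
      Exec c m m' t → Exec d m' m'' t' → Exec (.seq c d) m m'' (t + t' + 1)
  | ite_true {e : Expr} {c d : Prog} {m m' : Mem} {t : ℕ} :
      e.eval m ≠ 0 → Exec c m m' t → Exec (.ite e c d) m m' (e.cost m + t + 1)
  | ite_false {e : Expr} {c d : Prog} {m m' : Mem} {t : ℕ} :
      e.eval m = 0 → Exec d m m' t → Exec (.ite e c d) m m' (e.cost m + t + 1)
  | loop_done {e : Expr} {c : Prog} {m : Mem} :
      e.eval m = 0 → Exec (.loop e c) m m (e.cost m + 1)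
  | loop_step {e : Expr} {c : Prog} {m m' m'' : Mem} {t t' : ℕ} :
      e.eval m ≠ 0 → Exec c m m' t → Exec (.loop e c) m' m'' t' →
        Exec (.loop e c) m m'' (e.cost m + t + t' + 1)

/-- Initial memory: array `0` holds the length of the input and then the input; all other cells
are `0`. -/
def inputMem (w : List ℕ) : Mem
  | 0, 0 => w.length
  | 0, i + 1 => w.getD i 0
  | _ + 1, _ => 0

/-- The output: array `1` holds its length and then its entries. -/
def Mem.output (m : Mem) : List ℕ :=
  (List.range (m 1 0)).map fun i => m 1 (i + 1)

/-- Size of an input: the total bit length of its entries, plus one per entry. -/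
def inputSize (w : List ℕ) : ℕ :=
  (w.map fun x => x.size + 1).sum

end RAM

/-! ### Encodings -/

/-- The list `k, n`, followed by numerator and denominator of all payoffs, player by player; the
pure strategy profile `s` comes at position `∑ i, s i * n ^ i`. -/
def payoffCode {k n : ℕ} (num den : Fin k → (Fin k → Fin n) → ℕ) : List ℕ :=
  k :: n :: (List.finRange k).flatMap fun i =>
    (List.finRange (n ^ k)).flatMap fun t =>
      [num i (finFunctionFinEquiv.symm t), den i (finFunctionFinEquiv.symm t)]

/-- `w` is a code of the game `G`; fractions need not be in lowest terms. -/
def NormalFormGame.IsCode {k n : ℕ} (G : NormalFormGame k n) (w : List ℕ) : Prop :=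
  ∃ num den : Fin k → (Fin k → Fin n) → ℕ,
    (∀ i s, 0 < den i s ∧ G.payoff i s = (num i s : ℚ) / (den i s : ℚ)) ∧ w = payoffCode num den

/-- The values of the map of players, then those of the maps of strategies, player by player. -/
def GameMapping.code {k₁ n₁ k₂ n₂ : ℕ} (μ : GameMapping k₁ n₁ k₂ n₂) : List ℕ :=
  ((List.finRange k₁).map fun i => (μ.player i : ℕ)) ++
    (List.finRange k₁).flatMap fun i => (List.finRange n₁).map fun j => (μ.strategy i j : ℕ)

/-! ### Direct polynomial-time reductions from `k`NASH to 2NASH -/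

/-- There is a direct, polynomial-time reduction from `e₁(n)`-`k`NASH to `e₂(n)`-`2`NASH, where
`n` is the number of pure strategies per player of the game in question: one program that, for all
`k` and `n`, turns every code of a game `G` with `k` players and `n` pure strategies each into a
code of a 2-player game `G₂`, with `n₂` pure strategies each, together with a mapping that is a
direct reduction from `(G, e₁(n))` to `(G₂, e₂(n₂))`, in time polynomial in the size of the
input. -/
def DirectPolyTimeReduction (e₁ e₂ : ℕ → ℝ) : Prop :=
  ∃ (c : RAM.Prog) (T : Polynomial ℕ), ∀ (k n : ℕ), 1 ≤ k → 1 ≤ n →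
    ∀ (G : NormalFormGame k n) (w : List ℕ), G.IsCode w →
      ∃ (m : RAM.Mem) (t : ℕ), RAM.Exec c (RAM.inputMem w) m t ∧
        t ≤ T.eval (RAM.inputSize w) ∧
        ∃ (n₂ : ℕ) (G₂ : NormalFormGame 2 n₂) (μ : GameMapping k n 2 n₂) (v : List ℕ),
          G₂.IsCode v ∧ RAM.Mem.output m = v ++ μ.code ∧
            IsDirectReduction G (e₁ n) G₂ (e₂ n₂) μ

/-! ### Running time of programs on the random access machine -/

namespace RAM

/-! The two-player game simulates an arithmetic circuit. Player 0 is paid for imitating player 1, so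
at equilibrium every pure strategy in the support of player 0 is also used by player 1 and is
therefore nearly optimal in player 1's payoffs against player 0's mixture. After scaling that
mixture to total weight `D`, the weights `x` form a symmetric kind of equilibrium
(`Layout.IsEquilibrium`): each `v` with `x v > 0` has an almost maximal row value `L.row M x D v`,
where rows are affine in `x`.

Strategy `0` has row value identically zero, so rows of used strategies are at least `-η`. This
alone bounds every other weight by `8`, and since `D` exceeds `8 * L.size`, strategy `0` must be
used (`zero_pos`). Consequently all rows are at most `η`. A row of the form `c * (A - x v)` with `c
≥ 1` then forces `x v` to be `max 0 A` up to `η` (`IsGate.of_row`): strategies are rectified linear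
gates.

These gates multiply. Squaring uses `z ^ 2 = z - t / 2 + t ^ 2 / 4` with `t` the tent map of `z`;
iterating, the truncation error shrinks by `4` per level while gate errors stay a bounded multiple
of `θ` (`abs_sub_sq_le`). Polarization gives products, and two final gates clip the result to `[0,
1]` up to gate error. Chains of `k` blocks approximate the probability of each profile of the
opponents of each original player.

Strategy `j` of original player `i` has row `1 - (total weight of i) + (expected payoff) / D`. The
total weight is thus close to `1`, while differences between rows of the same player are payoff
differences divided by `D`. Hence used strategies are almost best responses, with error `D * η` plus
the circuit error (`payoff_le`).

With `E` the inverse of the desired error, `D = 2048 * E * L.size ^ 2` and `ε₂ ≤ 1 / (2 ^ 30 * E ^ 3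
* L.size ^ 4)` suffice (`Layout.isDirectReduction`). The number of levels is linear in `p n + k * n
^ k`, so the new game has polynomial size even when `E = 2 ^ p n`. Every output entry is computed by
one fixed expression from the input and two tables of powers, which bounds the running time
(`exists_time_reduction_le`). -/

theorem size_add_le (a b : ℕ) : (a + b).size ≤ a.size + b.size := by
  rcases Nat.eq_zero_or_pos a with rfl | ha
  · simp
  rcases Nat.eq_zero_or_pos b with rfl | hb
  · simp
  rw [Nat.size_le]
  have h1 := Nat.lt_size_self a
  have h2 := Nat.lt_size_self b
  have ha' := Nat.size_pos.2 ha
  have hb' := Nat.size_pos.2 hb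
  have h3 : 2 ^ a.size ≤ 2 ^ (a.size + b.size - 1) := Nat.pow_le_pow_right (by norm_num) (by omega)
  have h4 : 2 ^ b.size ≤ 2 ^ (a.size + b.size - 1) := Nat.pow_le_pow_right (by norm_num) (by omega)
  have h5 : 2 ^ (a.size + b.size) = 2 * 2 ^ (a.size + b.size - 1) := by
    rw [← pow_succ']; congr 1; omega
  omega

theorem size_mul_le (a b : ℕ) : (a * b).size ≤ a.size + b.size := by
  rw [Nat.size_le, pow_add]
  exact Nat.mul_lt_mul'' (Nat.lt_size_self a) (Nat.lt_size_self b)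

theorem size_le_self (a : ℕ) : a.size ≤ a := Nat.size_le.2 Nat.lt_two_pow_self

/-- All cells outside of the output array have at most `B` bits. -/
def Mem.Bounded (m : Mem) (B : ℕ) : Prop := ∀ a, a ≠ 1 → ∀ i, (m a i).size ≤ B

/-- The expression does not read the output array. -/
def Expr.AvoidsOutput : Expr → Prop
  | .lit _ => True
  | .get a e => a ≠ 1 ∧ e.AvoidsOutput
  | .add e f => e.AvoidsOutput ∧ f.AvoidsOutput
  | .sub e f => e.AvoidsOutput ∧ f.AvoidsOutput
  | .mul e f => e.AvoidsOutput ∧ f.AvoidsOutput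
  | .div e f => e.AvoidsOutput ∧ f.AvoidsOutput

/-- An expression has fixed shape and each operation at most adds the bit lengths of its operands,
so cost and result are linear in the word size. Reads of the output array are excluded so that `B`
need not account for what has been written there. -/
theorem Expr.exists_cost_le (e : Expr) (he : e.AvoidsOutput) :
    ∃ C : ℕ, ∀ (m : Mem) (B : ℕ), m.Bounded B →
      e.cost m ≤ C * (B + 1) ∧ (e.eval m).size ≤ C * (B + 1) := by
  induction e with
  | lit c =>
    refine ⟨c.size + 1, fun m B _ => ?_⟩
    simp only [Expr.cost, Expr.eval]
    constructor <;> nlinarith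
  | get a e ih =>
    obtain ⟨C, hC⟩ := ih he.2
    refine ⟨2 * C + 2, fun m B hB => ?_⟩
    have h1 := hC m B hB
    have h2 := hB a he.1 (e.eval m)
    simp only [Expr.cost, Expr.eval]
    constructor <;> nlinarith
  | add e f ihe ihf =>
    obtain ⟨C, hC⟩ := ihe he.1
    obtain ⟨C', hC'⟩ := ihf he.2
    refine ⟨2 * C + 2 * C' + 1, fun m B hB => ?_⟩
    have h1 := hC m B hB
    have h2 := hC' m B hB
    have h3 := size_add_le (e.eval m) (f.eval m)
    simp only [Expr.cost, Expr.eval]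
    constructor <;> nlinarith
  | sub e f ihe ihf =>
    obtain ⟨C, hC⟩ := ihe he.1
    obtain ⟨C', hC'⟩ := ihf he.2
    refine ⟨2 * C + 2 * C' + 1, fun m B hB => ?_⟩
    have h1 := hC m B hB
    have h2 := hC' m B hB
    have h3 := Nat.size_le_size (Nat.sub_le (e.eval m) (f.eval m))
    simp only [Expr.cost, Expr.eval]
    constructor <;> nlinarith
  | mul e f ihe ihf =>
    obtain ⟨C, hC⟩ := ihe he.1
    obtain ⟨C', hC'⟩ := ihf he.2
    refine ⟨2 * C + 2 * C' + 1, fun m B hB => ?_⟩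
    have h1 := hC m B hB
    have h2 := hC' m B hB
    have h3 := size_mul_le (e.eval m) (f.eval m)
    simp only [Expr.cost, Expr.eval]
    constructor <;> nlinarith
  | div e f ihe ihf =>
    obtain ⟨C, hC⟩ := ihe he.1
    obtain ⟨C', hC'⟩ := ihf he.2
    refine ⟨2 * C + 2 * C' + 1, fun m B hB => ?_⟩
    have h1 := hC m B hB
    have h2 := hC' m B hB
    have h3 := Nat.size_le_size (Nat.div_le_self (e.eval m) (f.eval m))
    simp only [Expr.cost, Expr.eval]
    constructor <;> nlinarith

theorem exists_time_set_le (a : ℕ) (e f : Expr) (he : e.AvoidsOutput) (hf : f.AvoidsOutput) :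
    ∃ C : ℕ, ∀ (m : Mem) (B : ℕ), m.Bounded B →
      ∃ t ≤ C * (B + 1), Exec (.set a e f) m (m.write a (e.eval m) (f.eval m)) t := by
  obtain ⟨C, hC⟩ := e.exists_cost_le he
  obtain ⟨C', hC'⟩ := f.exists_cost_le hf
  refine ⟨2 * C + 2 * C' + 1, fun m B hB => ⟨_, ?_, Exec.set a e f m⟩⟩
  have h1 := hC m B hB
  have h2 := hC' m B hB
  nlinarith

/-- The loop counter. -/
def counter : Expr := .get 2 (.lit 0)

/-- `for counter < e do a[f] := g`, without the initialization of the counter. -/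
def forLoop (e : Expr) (a : ℕ) (f g : Expr) : Prog :=
  .loop (.sub e counter) (.seq (.set a f g) (.set 2 (.lit 0) (.add counter (.lit 1))))

/-- A loop that runs through the memories `M 0, M 1, …, M b` takes time linear in the number of
rounds and in the bit length of the memory cells. -/
theorem exists_time_forLoop_le (e : Expr) (a : ℕ) (f g : Expr) (he : e.AvoidsOutput)
    (hf : f.AvoidsOutput) (hg : g.AvoidsOutput) (ha : a ≠ 2) :
    ∃ C : ℕ, ∀ (M : ℕ → Mem) (b B : ℕ), (∀ i ≤ b, (M i).Bounded B) →
      (∀ i ≤ b, e.eval (M i) = b) → (∀ i ≤ b, M i 2 0 = i) →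
      (∀ i < b, ((M i).write a (f.eval (M i)) (g.eval (M i))).write 2 0 (i + 1) = M (i + 1)) →
      ∃ t ≤ C * (B + 1) * (b + 1), Exec (forLoop e a f g) (M 0) (M b) t := by
  have hcond : (Expr.sub e counter).AvoidsOutput := ⟨he, by simp [counter, Expr.AvoidsOutput]⟩
  obtain ⟨C₁, hC₁⟩ := Expr.exists_cost_le _ hcond
  obtain ⟨C₂, hC₂⟩ := exists_time_set_le a f g hf hg
  refine ⟨C₁ + C₂ + 20, fun M b B hB heb hcnt hstep => ?_⟩
  -- Induction on the number `d` of remaining rounds, because the execution relation unfolds a loop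
  -- from its first round.
  suffices H : ∀ d i, i + d = b →
      ∃ t ≤ (C₁ + C₂ + 20) * (B + 1) * (d + 1), Exec (forLoop e a f g) (M i) (M b) t from
    H b 0 (by omega)
  intro d
  induction d with
  | zero =>
    intro i hi
    obtain rfl : i = b := by omega
    refine ⟨_, ?_, Exec.loop_done ?_⟩
    · have := (hC₁ _ B (hB i le_rfl)).1
      nlinarith
    -- Truncated subtraction makes the condition vanish exactly when the counter has reached the
    -- bound.
    · simp [Expr.eval, counter, heb i le_rfl, hcnt i le_rfl]
  | succ d ih =>
    intro i hi
    obtain ⟨t, ht, hex⟩ := ih (i + 1) (by omega)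
    have hib : i ≤ b := by omega
    obtain ⟨s, hs, hset⟩ := hC₂ _ B (hB i hib)
    set m₁ := (M i).write a (f.eval (M i)) (g.eval (M i)) with hm₁
    have hm2 : m₁ 2 0 = i := by
      rw [hm₁, Mem.write, Function.update_of_ne ha.symm, hcnt i hib]
    have hset2 := Exec.set 2 (.lit 0) (.add counter (.lit 1)) m₁
    have hwr : m₁.write 2 (Expr.eval m₁ (.lit 0)) (Expr.eval m₁ (.add counter (.lit 1))) =
        M (i + 1) := by
      rw [← hstep i (by omega)]
      simp only [Expr.eval, counter, hm2]
      rfl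
    rw [hwr] at hset2
    refine ⟨_, ?_, Exec.loop_step ?_ (Exec.seq hset hset2) hex⟩
    · have h1 := (hC₁ _ B (hB i hib)).1
      have h2 := hB i hib 2 (by norm_num) 0
      have h3 := hB (i + 1) (by omega) 2 (by norm_num) 0
      rw [hcnt i hib] at h2
      rw [hcnt _ (by omega : i + 1 ≤ b)] at h3
      have h4 : (C₁ + C₂ + 20) * (B + 1) * (d + 1 + 1) =
          (C₁ + C₂ + 20) * (B + 1) * (d + 1) + C₁ * (B + 1) + C₂ * (B + 1) + 20 * (B + 1) := by
        ring
      have h5 : Expr.cost m₁ (.lit 0) + Expr.cost m₁ (.add counter (.lit 1)) +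
          (Expr.eval m₁ (.lit 0)).size + (Expr.eval m₁ (.add counter (.lit 1))).size + 1 =
          2 * i.size + (i + 1).size + 8 := by
        simp only [Expr.cost, Expr.eval, counter, hm2, Nat.size_zero, Nat.size_one]
        ring
      rw [h4, h5]
      omega
    · simp only [Expr.eval, counter, heb i hib, hcnt i hib]
      omega

/-! ### Expressions -/

namespace Expr

instance : Add Expr := ⟨.add⟩
instance : Sub Expr := ⟨.sub⟩
instance : Mul Expr := ⟨.mul⟩
instance : Div Expr := ⟨.div⟩
instance (c : ℕ) : OfNat Expr c := ⟨.lit c⟩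

variable (m : Mem) (e f g h : Expr)

@[simp] theorem eval_add : (e + f).eval m = e.eval m + f.eval m := by
  change Expr.eval m (.add e f) = _; rw [Expr.eval]
@[simp] theorem eval_sub : (e - f).eval m = e.eval m - f.eval m := by
  change Expr.eval m (.sub e f) = _; rw [Expr.eval]
@[simp] theorem eval_mul : (e * f).eval m = e.eval m * f.eval m := by
  change Expr.eval m (.mul e f) = _; rw [Expr.eval]
@[simp] theorem eval_div : (e / f).eval m = e.eval m / f.eval m := by
  change Expr.eval m (.div e f) = _; rw [Expr.eval]
@[simp] theorem eval_ofNat (c : ℕ) : (no_index (OfNat.ofNat c) : Expr).eval m = c := by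
  change Expr.eval m (.lit c) = _; rw [Expr.eval]
@[simp] theorem eval_get (a : ℕ) : (get a e).eval m = m a (e.eval m) := by
  rw [Expr.eval]

@[simp] theorem avoids_add : (e + f).AvoidsOutput ↔ e.AvoidsOutput ∧ f.AvoidsOutput := Iff.rfl
@[simp] theorem avoids_sub : (e - f).AvoidsOutput ↔ e.AvoidsOutput ∧ f.AvoidsOutput := Iff.rfl
@[simp] theorem avoids_mul : (e * f).AvoidsOutput ↔ e.AvoidsOutput ∧ f.AvoidsOutput := Iff.rfl
@[simp] theorem avoids_div : (e / f).AvoidsOutput ↔ e.AvoidsOutput ∧ f.AvoidsOutput := Iff.rfl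
@[simp] theorem avoids_ofNat (c : ℕ) : (no_index (OfNat.ofNat c) : Expr).AvoidsOutput := trivial
@[simp] theorem avoids_get (a : ℕ) : (get a e).AvoidsOutput ↔ a ≠ 1 ∧ e.AvoidsOutput := Iff.rfl

/-- Remainder. -/
def mod : Expr := e - e / f * f

@[simp] theorem eval_mod : (mod e f).eval m = e.eval m % f.eval m := by
  simp only [mod, eval_sub, eval_mul, eval_div]
  have := Nat.mod_add_div (e.eval m) (f.eval m)
  rw [mul_comm] at this
  omega

@[simp] theorem avoids_mod : (mod e f).AvoidsOutput ↔ e.AvoidsOutput ∧ f.AvoidsOutput := by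
  simp [mod]; try tauto

/-- `1` if the two values agree and `0` otherwise. -/
def eqInd : Expr := 1 - ((e - f) + (f - e))

@[simp] theorem eval_eqInd : (eqInd e f).eval m = if e.eval m = f.eval m then 1 else 0 := by
  simp only [eqInd, eval_sub, eval_add, eval_ofNat]
  split_ifs <;> omega

@[simp] theorem avoids_eqInd : (eqInd e f).AvoidsOutput ↔ e.AvoidsOutput ∧ f.AvoidsOutput := by
  simp [eqInd]; tauto

/-- `if e = f then g else h`. -/
def ifEq : Expr := eqInd e f * g + (1 - eqInd e f) * h

@[simp] theorem eval_ifEq :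
    (ifEq e f g h).eval m = if e.eval m = f.eval m then g.eval m else h.eval m := by
  simp only [ifEq, eval_mul, eval_add, eval_sub, eval_eqInd, eval_ofNat]
  split_ifs <;> simp

@[simp] theorem avoids_ifEq : (ifEq e f g h).AvoidsOutput ↔
    e.AvoidsOutput ∧ f.AvoidsOutput ∧ g.AvoidsOutput ∧ h.AvoidsOutput := by
  simp [ifEq]; tauto

/-- `if e < f then g else h`. -/
def ifLt : Expr := ifEq (f - e) 0 h g

@[simp] theorem eval_ifLt :
    (ifLt e f g h).eval m = if e.eval m < f.eval m then g.eval m else h.eval m := by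
  simp only [ifLt, eval_ifEq, eval_sub, eval_ofNat]
  by_cases hlt : e.eval m < f.eval m
  · rw [if_pos hlt, if_neg (by omega)]
  · rw [if_neg hlt, if_pos (by omega)]

@[simp] theorem avoids_ifLt : (ifLt e f g h).AvoidsOutput ↔
    e.AvoidsOutput ∧ f.AvoidsOutput ∧ g.AvoidsOutput ∧ h.AvoidsOutput := by
  simp [ifLt]; tauto

/-- Every polynomial with natural coefficients is an expression. -/
theorem exists_eval_eq_polynomial (p : Polynomial ℕ) (he : e.AvoidsOutput) :
    ∃ f : Expr, f.AvoidsOutput ∧ ∀ m : Mem, f.eval m = p.eval (e.eval m) := by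
  induction p using Polynomial.induction_on' with
  | add p q hp hq =>
    obtain ⟨f, hf, hf'⟩ := hp
    obtain ⟨g, hg, hg'⟩ := hq
    exact ⟨f + g, ⟨hf, hg⟩, fun m => by simp [hf', hg']⟩
  | monomial d c =>
    induction d with
    | zero => exact ⟨.lit c, trivial, fun m => by simp [Expr.eval]⟩
    | succ d ih =>
      obtain ⟨f, hf, hf'⟩ := ih
      exact ⟨f * e, ⟨hf, he⟩, fun m => by simp [hf', pow_succ, mul_assoc]⟩

end Expr

end RAM

/-! ### The layout of the two-player game

The pure strategies of each of the two players are numbered as follows: a strategy `0` with zero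
payoff, a strategy `1` for the constant one, the strategies `2 + i * n + j` for the strategies of
the original players, and then one block for each multiplication. Block `(i * n ^ k + s) * k + l`
multiplies the product for the players other than `i` before `l` in the profile `s` with the
probability of strategy `s l` of player `l`; for `l = i`, it multiplies with `1`. -/

/-- Dimensions of the original game and the number of levels of the squaring circuits. -/
structure Layout where
  k : ℕ
  n : ℕ
  R : ℕ

/-- Kronecker symbol. -/
def kron (u c : ℕ) : ℕ := if u = c then 1 else 0

/-- Since `x` vanishes beyond `b`, the selected index need not be in range: references past the last
block simply read `0`. -/
theorem sum_range_kron {b : ℕ} {x : ℕ → ℝ} (hx : ∀ u, b ≤ u → x u = 0) (c : ℕ) :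
    ∑ u ∈ Finset.range b, (kron u c : ℝ) * x u = x c := by
  simp only [kron, Nat.cast_ite, Nat.cast_one, Nat.cast_zero, ite_mul, one_mul, zero_mul,
    Finset.sum_ite_eq', Finset.mem_range]
  split_ifs with h
  · rfl
  · exact (hx c (by omega)).symm

theorem sum_range_mul_eq (f : ℕ → ℝ) (a b : ℕ) :
    ∑ w ∈ Finset.range (a * b), f w = ∑ i ∈ Finset.range a, ∑ j ∈ Finset.range b, f (i * b + j) := by
  induction a with
  | zero => simp
  | succ a ih => rw [Nat.succ_mul, Finset.sum_range_add, ih, Finset.sum_range_succ]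

theorem kron_le_one (u c : ℕ) : kron u c ≤ 1 := by
  unfold kron; split_ifs <;> omega

namespace Layout

variable (L : Layout)

/-- Number of profiles. -/
def profiles : ℕ := L.n ^ L.k

/-- Number of the first strategy of the first block. -/
def base : ℕ := 2 + L.k * L.n

/-- Size of a block. -/
def width : ℕ := 6 * L.R + 2

/-- Number of pure strategies per player. -/
def size : ℕ := L.base + L.k * L.profiles * L.k * L.width

/-- Table of powers. -/
def pow (i : ℕ) : ℕ := if i ≤ L.k then L.n ^ i else 0

/-- The strategy of player `i` in the profile `s`. -/
def digit (s i : ℕ) : ℕ := s / L.pow i % L.n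

/-- First factor of a block. -/
def left (b : ℕ) : ℕ := if b % L.k = 0 then 1 else L.base + b * L.width - 1

/-- Second factor of a block. -/
def right (b : ℕ) : ℕ :=
  if b % L.k = b / L.k / L.profiles then 1
  else 2 + b % L.k * L.n + L.digit (b / L.k % L.profiles) (b % L.k)

/-- Block of a strategy. -/
def block (v : ℕ) : ℕ := (v - L.base) / L.width

/-- Position of a strategy in its block. -/
def offset (v : ℕ) : ℕ := (v - L.base) % L.width

/-- First strategy of a block. -/
def start (b : ℕ) : ℕ := L.base + b * L.width

/-- Coefficients, shifted by `8`, of the rows of the blocks. -/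
def blockCoef (v u : ℕ) : ℕ :=
  if L.offset v = 6 * L.R + 1 then 8 - (kron u (v - 1) + kron u v)
  else if L.offset v = 6 * L.R then
    8 + (4 * kron u (L.start (L.block v) + 5) + 2 * kron u (L.right (L.block v))) -
      (4 * kron u (L.start (L.block v) + 2) + 2 * kron u (L.left (L.block v)) + 4 * kron u v)
  else if L.offset v % 3 = 1 then 8 - (2 * kron u (v - 1) + kron u v)
  else if L.offset v % 3 = 2 then
    8 + (4 * kron u (v - 2) + kron u (v + 6)) - (2 * kron u (v + 4) + 4 * kron u v)
  else if L.offset v = 0 then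
    8 + (kron u (L.left (L.block v)) + kron u (L.right (L.block v))) - 2 * kron u v
  else if L.offset v = 3 then
    8 + kron u (L.left (L.block v)) - (kron u (L.right (L.block v)) + 2 * kron u v)
  else 8 - (2 * kron u (v - 5) + 2 * kron u (v - 6) + kron u v)

/-- Constant terms of the rows of the blocks. -/
def blockConst (v : ℕ) : ℕ :=
  if L.offset v = 6 * L.R + 1 then 1
  else if L.offset v = 6 * L.R then 3
  else if L.offset v % 3 = 1 then 1
  else if L.offset v % 3 = 2 then 0
  else if L.offset v = 0 then 0
  else if L.offset v = 3 then 1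
  else 2

/-- Original player of a strategy. -/
def player (v : ℕ) : ℕ := (v - 2) / L.n

/-- Coefficients, shifted by `8`, of all rows. -/
def coef (v u : ℕ) : ℕ :=
  if v = 0 then 8
  else if v = 1 then 8 - kron u 1
  else if v < L.base then
    if u < 2 then 8 else if u < L.base then 8 - kron (L.player u) (L.player v) else 8
  else L.blockCoef v u

/-- Constant terms of all rows. -/
def const (v : ℕ) : ℕ := if v = 0 then 0 else if v < L.base then 1 else L.blockConst v

/-- Number of the pair of a player and a profile that a block belongs to. -/
def pair (u : ℕ) : ℕ := (u - L.base) / (L.k * L.width)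

/-- Whether strategy `u` carries the probability that is multiplied with a payoff for `v`. -/
def hit (v u : ℕ) : ℕ :=
  if v < 2 then 0
  else if v < L.base then
    if u < L.base then 0
    else kron ((u - L.base) % (L.k * L.width)) (L.k * L.width - 1) *
      (kron (L.pair u / L.profiles) (L.player v) *
        kron (L.digit (L.pair u % L.profiles) (L.player v)) ((v - 2) % L.n))
  else 0

/-- The payoff, up to scaling and shift, of strategy `v` against the weights `x`; the payoffs of
the original game are `M`. -/
noncomputable def row (M x : ℕ → ℝ) (D : ℝ) (v : ℕ) : ℝ :=
  L.const v + ∑ u ∈ Finset.range L.size, ((L.coef v u : ℝ) - 8) * x u +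
    (∑ u ∈ Finset.range L.size, (L.hit v u * M (L.pair u)) * x u) / D

/-- Strategy number `o` of block `b`. -/
def node (b o : ℕ) : ℕ := L.start b + o

variable {L}

theorem width_pos : 0 < L.width := by unfold width; omega

theorem block_node {b o : ℕ} (ho : o < L.width) : L.block (L.node b o) = b := by
  have : L.base + b * L.width + o - L.base = o + b * L.width := by omega
  rw [block, node, start, this, Nat.add_mul_div_right _ _ width_pos, Nat.div_eq_of_lt ho, zero_add]

theorem offset_node {b o : ℕ} (ho : o < L.width) : L.offset (L.node b o) = o := by
  have : L.base + b * L.width + o - L.base = o + b * L.width := by omega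
  rw [offset, node, start, this, Nat.add_mul_mod_self_right, Nat.mod_eq_of_lt ho]

theorem base_le_node (b o : ℕ) : L.base ≤ L.node b o := by unfold node start; omega

theorem two_le_base : 2 ≤ L.base := by unfold base; omega

theorem node_lt_size {b o : ℕ} (hb : b < L.k * L.profiles * L.k) (ho : o < L.width) :
    L.node b o < L.size := by
  have : (b + 1) * L.width ≤ L.k * L.profiles * L.k * L.width := Nat.mul_le_mul_right _ hb
  unfold node start size
  nlinarith

theorem exists_node_eq {v : ℕ} (hv : L.base ≤ v) (hv' : v < L.size) :
    ∃ b o, b < L.k * L.profiles * L.k ∧ o < L.width ∧ v = L.node b o := by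
  refine ⟨L.block v, L.offset v, ?_, Nat.mod_lt _ width_pos, ?_⟩
  · rw [block, Nat.div_lt_iff_lt_mul width_pos]
    unfold size at hv'
    omega
  · have := Nat.mod_add_div (v - L.base) L.width
    unfold node start block offset
    rw [mul_comm] at this
    omega

theorem hit_block {v u : ℕ} (hv : L.base ≤ v) : L.hit v u = 0 := by
  have := L.two_le_base
  rw [hit, if_neg (by omega), if_neg (by omega)]

/-! ### Rows of the payoff matrix as gates -/

section rows

variable {M x : ℕ → ℝ} {D : ℝ}

theorem row_eq_of_hit_eq_zero {v : ℕ} (h : ∀ u, L.hit v u = 0) :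
    L.row M x D v = L.const v + ∑ u ∈ Finset.range L.size, ((L.coef v u : ℝ) - 8) * x u := by
  simp [row, h]

theorem row_zero : L.row M x D 0 = 0 := by
  rw [row_eq_of_hit_eq_zero (fun u => by simp [hit])]
  simp [const, coef]

theorem row_one (hx : ∀ u, L.size ≤ u → x u = 0) : L.row M x D 1 = 1 - x 1 := by
  have := L.two_le_base
  rw [row_eq_of_hit_eq_zero (fun u => by simp [hit])]
  have h1 : ∀ u, ((L.coef 1 u : ℝ) - 8) * x u = -((kron u 1 : ℝ) * x u) := fun u => by
    have := kron_le_one u 1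
    rw [coef, if_neg one_ne_zero, if_pos rfl, Nat.cast_sub (by omega)]
    push_cast; ring
  simp only [h1, Finset.sum_neg_distrib, sum_range_kron hx]
  rw [const, if_neg one_ne_zero, if_pos (by omega)]
  push_cast; ring

/-- Inside a block two squaring circuits `σ = 0, 1` are interleaved: offsets `6 * r + 3 * σ`, `+ 1`,
`+ 2` hold, at level `r`, the iterate `z` of the tent map, the auxiliary gate `a` and the
approximate square `S`. Offset `6 * R` holds the complement of the product, `6 * R + 1` the product
itself. -/
theorem row_node {b o : ℕ} :
    L.row M x D (L.node b o) = L.blockConst (L.node b o) +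
      ∑ u ∈ Finset.range L.size, ((L.blockCoef (L.node b o) u : ℝ) - 8) * x u := by
  have h1 := L.base_le_node b o
  have h2 := L.two_le_base
  rw [row_eq_of_hit_eq_zero (fun u => hit_block h1), const, if_neg (by omega), if_neg (by omega)]
  congr 1
  refine Finset.sum_congr rfl fun u _ => ?_
  rw [coef, if_neg (by omega), if_neg (by omega), if_neg (by omega)]

theorem row_output (hx : ∀ u, L.size ≤ u → x u = 0) {b : ℕ} :
    L.row M x D (L.node b (6 * L.R + 1)) =
      1 * ((1 - x (L.node b (6 * L.R))) - x (L.node b (6 * L.R + 1))) := by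
  have ho : 6 * L.R + 1 < L.width := by unfold width; omega
  have h1 : ∀ u, ((L.blockCoef (L.node b (6 * L.R + 1)) u : ℝ) - 8) * x u =
      -((kron u (L.node b (6 * L.R)) : ℝ) * x u) -
        (kron u (L.node b (6 * L.R + 1)) : ℝ) * x u := fun u => by
    have h1 := kron_le_one u (L.node b (6 * L.R))
    have h2 := kron_le_one u (L.node b (6 * L.R + 1))
    rw [blockCoef, offset_node ho, if_pos rfl]
    rw [show L.node b (6 * L.R + 1) - 1 = L.node b (6 * L.R) by unfold node; omega,
      Nat.cast_sub (by omega)]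
    push_cast; ring
  rw [row_node]
  simp only [h1, Finset.sum_sub_distrib, Finset.sum_neg_distrib, sum_range_kron hx]
  rw [blockConst, offset_node ho, if_pos rfl]
  push_cast; ring

theorem row_complement (hx : ∀ u, L.size ≤ u → x u = 0) {b : ℕ} :
    L.row M x D (L.node b (6 * L.R)) =
      4 * ((1 - (x (L.node b 2) - x (L.node b 5) + (x (L.left b) - x (L.right b)) / 2 + 1 / 4)) -
        x (L.node b (6 * L.R))) := by
  have ho : 6 * L.R < L.width := by unfold width; omega
  have h1 : ∀ u, ((L.blockCoef (L.node b (6 * L.R)) u : ℝ) - 8) * x u =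
      4 * ((kron u (L.node b 5) : ℝ) * x u) + 2 * ((kron u (L.right b) : ℝ) * x u) -
      4 * ((kron u (L.node b 2) : ℝ) * x u) - 2 * ((kron u (L.left b) : ℝ) * x u) -
        4 * ((kron u (L.node b (6 * L.R)) : ℝ) * x u) := fun u => by
    have h1 := kron_le_one u (L.node b 2)
    have h2 := kron_le_one u (L.left b)
    have h3 := kron_le_one u (L.node b (6 * L.R))
    have h4 : 4 * kron u (L.start b + 2) + 2 * kron u (L.left b) +
        4 * kron u (L.node b (6 * L.R)) ≤
        8 + (4 * kron u (L.start b + 5) + 2 * kron u (L.right b)) := by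
      -- The subtracted coefficients add up to `10`, but two of the strategies concerned are
      -- distinct, so at most `6` is subtracted at any `u` and truncation does not occur.
      have h5 : kron u (L.start b + 2) + kron u (L.node b (6 * L.R)) ≤ 1 := by
        unfold kron node
        split_ifs <;> omega
      omega
    rw [blockCoef, offset_node ho, if_neg (by omega), if_pos rfl, block_node ho, Nat.cast_sub h4]
    push_cast; unfold node; ring
  rw [row_node]
  simp only [h1, Finset.sum_sub_distrib, Finset.sum_add_distrib, ← Finset.mul_sum,
    sum_range_kron hx]
  rw [blockConst, offset_node ho, if_neg (by omega), if_pos rfl]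
  push_cast; ring

theorem row_kink (hx : ∀ u, L.size ≤ u → x u = 0) {b o : ℕ} (ho : o < 6 * L.R) (ho' : o % 3 = 1) :
    L.row M x D (L.node b o) = 1 * ((1 - 2 * x (L.node b (o - 1))) - x (L.node b o)) := by
  have hw : o < L.width := by unfold width; omega
  have h1 : ∀ u, ((L.blockCoef (L.node b o) u : ℝ) - 8) * x u =
      -(2 * ((kron u (L.node b (o - 1)) : ℝ) * x u)) -
        (kron u (L.node b o) : ℝ) * x u := fun u => by
    have h1 := kron_le_one u (L.node b (o - 1))
    have h2 := kron_le_one u (L.node b o)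
    rw [blockCoef, offset_node hw, if_neg (by omega), if_neg (by omega), if_pos ho',
      show L.node b o - 1 = L.node b (o - 1) by unfold node; omega, Nat.cast_sub (by omega)]
    push_cast; ring
  rw [row_node]
  simp only [h1, Finset.sum_sub_distrib, Finset.sum_neg_distrib, ← Finset.mul_sum,
    sum_range_kron hx]
  rw [blockConst, offset_node hw, if_neg (by omega), if_neg (by omega), if_pos ho']
  push_cast; ring

/-- The gate for `z - z' / 2 + S' / 4`, with `z'` and `S'` taken from the next level. At the last
level these references leave the squaring circuit and read unrelated strategies; only boundedness is
used there. -/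
theorem row_square (hx : ∀ u, L.size ≤ u → x u = 0) {b o : ℕ} (ho : o < 6 * L.R)
    (ho' : o % 3 = 2) :
    L.row M x D (L.node b o) =
      4 * ((x (L.node b (o - 2)) - x (L.node b (o + 4)) / 2 + x (L.node b (o + 6)) / 4) -
        x (L.node b o)) := by
  have hw : o < L.width := by unfold width; omega
  have h1 : ∀ u, ((L.blockCoef (L.node b o) u : ℝ) - 8) * x u =
      4 * ((kron u (L.node b (o - 2)) : ℝ) * x u) + (kron u (L.node b (o + 6)) : ℝ) * x u -
      2 * ((kron u (L.node b (o + 4)) : ℝ) * x u) -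
        4 * ((kron u (L.node b o) : ℝ) * x u) := fun u => by
    have h1 := kron_le_one u (L.node b (o + 4))
    have h2 := kron_le_one u (L.node b o)
    rw [blockCoef, offset_node hw, if_neg (by omega), if_neg (by omega), if_neg (by omega),
      if_pos ho', show L.node b o - 2 = L.node b (o - 2) by unfold node; omega,
      show L.node b o + 6 = L.node b (o + 6) by unfold node; omega,
      show L.node b o + 4 = L.node b (o + 4) by unfold node; omega, Nat.cast_sub (by omega)]
    push_cast; ring
  rw [row_node]
  simp only [h1, Finset.sum_sub_distrib, Finset.sum_add_distrib, ← Finset.mul_sum,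
    sum_range_kron hx]
  rw [blockConst, offset_node hw, if_neg (by omega), if_neg (by omega), if_neg (by omega),
    if_pos ho']
  push_cast; ring

theorem row_mean (hx : ∀ u, L.size ≤ u → x u = 0) {b : ℕ} (hR : 0 < L.R) :
    L.row M x D (L.node b 0) =
      2 * ((x (L.left b) + x (L.right b)) / 2 - x (L.node b 0)) := by
  have hw : 0 < L.width := width_pos
  have h1 : ∀ u, ((L.blockCoef (L.node b 0) u : ℝ) - 8) * x u =
      (kron u (L.left b) : ℝ) * x u + (kron u (L.right b) : ℝ) * x u -
        2 * ((kron u (L.node b 0) : ℝ) * x u) := fun u => by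
    have h2 := kron_le_one u (L.node b 0)
    rw [blockCoef, offset_node hw, block_node hw, if_neg (by omega), if_neg (by omega),
      if_neg (by omega), if_neg (by omega), if_pos rfl, Nat.cast_sub (by omega)]
    push_cast; ring
  rw [row_node]
  simp only [h1, Finset.sum_sub_distrib, Finset.sum_add_distrib, ← Finset.mul_sum,
    sum_range_kron hx]
  rw [blockConst, offset_node hw, if_neg (by omega), if_neg (by omega), if_neg (by omega),
    if_neg (by omega), if_pos rfl]
  push_cast; ring

theorem row_diff (hx : ∀ u, L.size ≤ u → x u = 0) {b : ℕ} (hR : 0 < L.R) :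
    L.row M x D (L.node b 3) =
      2 * ((x (L.left b) - x (L.right b) + 1) / 2 - x (L.node b 3)) := by
  have hw : 3 < L.width := by unfold width; omega
  have h1 : ∀ u, ((L.blockCoef (L.node b 3) u : ℝ) - 8) * x u =
      (kron u (L.left b) : ℝ) * x u - (kron u (L.right b) : ℝ) * x u -
        2 * ((kron u (L.node b 3) : ℝ) * x u) := fun u => by
    have h2 := kron_le_one u (L.node b 3)
    have h3 := kron_le_one u (L.right b)
    rw [blockCoef, offset_node hw, block_node hw, if_neg (by omega), if_neg (by omega),
      if_neg (by omega), if_neg (by omega), if_neg (by omega), if_pos rfl,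
      Nat.cast_sub (by omega)]
    push_cast; ring
  rw [row_node]
  simp only [h1, Finset.sum_sub_distrib, ← Finset.mul_sum, sum_range_kron hx]
  rw [blockConst, offset_node hw, if_neg (by omega), if_neg (by omega), if_neg (by omega),
    if_neg (by omega), if_neg (by omega), if_pos rfl]
  push_cast; ring

theorem row_tent (hx : ∀ u, L.size ≤ u → x u = 0) {b o : ℕ} (ho : o < 6 * L.R)
    (ho' : o % 3 = 0) (ho6 : 6 ≤ o) :
    L.row M x D (L.node b o) =
      1 * ((2 - 2 * x (L.node b (o - 5)) - 2 * x (L.node b (o - 6))) - x (L.node b o)) := by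
  have hw : o < L.width := by unfold width; omega
  have h1 : ∀ u, ((L.blockCoef (L.node b o) u : ℝ) - 8) * x u =
      -(2 * ((kron u (L.node b (o - 5)) : ℝ) * x u)) -
        2 * ((kron u (L.node b (o - 6)) : ℝ) * x u) -
        (kron u (L.node b o) : ℝ) * x u := fun u => by
    have h1 := kron_le_one u (L.node b (o - 5))
    have h2 := kron_le_one u (L.node b (o - 6))
    have h3 := kron_le_one u (L.node b o)
    rw [blockCoef, offset_node hw, if_neg (by omega), if_neg (by omega), if_neg (by omega),
      if_neg (by omega), if_neg (by omega), if_neg (by omega),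
      show L.node b o - 5 = L.node b (o - 5) by unfold node; omega,
      show L.node b o - 6 = L.node b (o - 6) by unfold node; omega, Nat.cast_sub (by omega)]
    push_cast; ring
  rw [row_node]
  simp only [h1, Finset.sum_sub_distrib, Finset.sum_neg_distrib, ← Finset.mul_sum,
    sum_range_kron hx]
  rw [blockConst, offset_node hw, if_neg (by omega), if_neg (by omega), if_neg (by omega),
      if_neg (by omega), if_neg (by omega), if_neg (by omega)]
  push_cast; ring

/-- The coefficients see only the total weight of player `i`, whatever `j` is. The dependence on `j`
is confined to the last sum, which runs over the outputs of the final blocks of the chains for `i`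
whose profile has `j` in place `i`. -/
theorem row_player {i j : ℕ} (hi : i < L.k) (hj : j < L.n) :
    L.row M x D (2 + i * L.n + j) =
      1 - ∑ j' ∈ Finset.range L.n, x (2 + i * L.n + j') +
        (∑ s ∈ Finset.range L.profiles, (kron (L.digit s i) j : ℝ) * M (i * L.profiles + s) *
          x (L.node ((i * L.profiles + s) * L.k + (L.k - 1)) (6 * L.R + 1))) / D := by
  have hn : 0 < L.n := by omega
  have hk : 0 < L.k := by omega
  have hN : 0 < L.profiles := Nat.pow_pos hn
  have hv : 2 + i * L.n + j < L.base := by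
    have : (i + 1) * L.n ≤ L.k * L.n := Nat.mul_le_mul_right _ hi
    unfold base
    nlinarith
  have hpl : ∀ i' j' : ℕ, j' < L.n → L.player (2 + i' * L.n + j') = i' := fun i' j' hj' => by
    rw [player, show 2 + i' * L.n + j' - 2 = j' + i' * L.n by omega,
      Nat.add_mul_div_right _ _ hn, Nat.div_eq_of_lt hj', zero_add]
  have hmod : (2 + i * L.n + j - 2) % L.n = j := by
    rw [show 2 + i * L.n + j - 2 = j + i * L.n by omega, Nat.add_mul_mod_self_right,
      Nat.mod_eq_of_lt hj]
  have hcoef : ∑ u ∈ Finset.range L.size, ((L.coef (2 + i * L.n + j) u : ℝ) - 8) * x u =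
      -∑ j' ∈ Finset.range L.n, x (2 + i * L.n + j') := by
    have hlow : ∀ u ∈ Finset.range 2, ((L.coef (2 + i * L.n + j) u : ℝ) - 8) * x u = 0 := by
      intro u hu
      rw [Finset.mem_range] at hu
      rw [coef, if_neg (by omega), if_neg (by omega), if_pos hv, if_pos hu]
      norm_num
    have hhigh : ∀ w ∈ Finset.range (L.k * L.profiles * L.k * L.width),
        ((L.coef (2 + i * L.n + j) (L.base + w) : ℝ) - 8) * x (L.base + w) = 0 := by
      intro w _
      have := L.two_le_base
      rw [coef, if_neg (by omega), if_neg (by omega), if_pos hv, if_neg (by omega),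
        if_neg (by omega)]
      norm_num
    have hmid : ∀ i' ∈ Finset.range L.k, ∑ j' ∈ Finset.range L.n,
        ((L.coef (2 + i * L.n + j) (2 + (i' * L.n + j')) : ℝ) - 8) * x (2 + (i' * L.n + j')) =
        if i' = i then -∑ j' ∈ Finset.range L.n, x (2 + i * L.n + j') else 0 := by
      intro i' hi'
      rw [Finset.mem_range] at hi'
      have h1 : ∀ j' ∈ Finset.range L.n,
          ((L.coef (2 + i * L.n + j) (2 + (i' * L.n + j')) : ℝ) - 8) * x (2 + (i' * L.n + j')) =
          if i' = i then -x (2 + i * L.n + j') else 0 := by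
        intro j' hj'
        rw [Finset.mem_range] at hj'
        have h2 : 2 + (i' * L.n + j') < L.base := by
          have : (i' + 1) * L.n ≤ L.k * L.n := Nat.mul_le_mul_right _ hi'
          unfold base
          nlinarith
        rw [coef, if_neg (by omega), if_neg (by omega), if_pos hv, if_neg (by omega), if_pos h2,
          ← add_assoc, hpl _ _ hj', hpl _ _ hj, kron]
        split_ifs with h
        · rw [h]; norm_num
        · norm_num
      rw [Finset.sum_congr rfl h1]
      split_ifs
      · rw [Finset.sum_neg_distrib]
      · simp
    rw [size, Finset.sum_range_add, Finset.sum_eq_zero hhigh, add_zero, base,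
      Finset.sum_range_add, Finset.sum_eq_zero hlow, zero_add, sum_range_mul_eq,
      Finset.sum_congr rfl hmid, Finset.sum_ite_eq', if_pos (Finset.mem_range.2 hi)]
  have hhit : ∑ u ∈ Finset.range L.size, (L.hit (2 + i * L.n + j) u * M (L.pair u)) * x u =
      ∑ s ∈ Finset.range L.profiles, (kron (L.digit s i) j : ℝ) * M (i * L.profiles + s) *
          x (L.node ((i * L.profiles + s) * L.k + (L.k - 1)) (6 * L.R + 1)) := by
    have hkw : 0 < L.k * L.width := Nat.mul_pos hk width_pos
    have hlow : ∀ u ∈ Finset.range L.base,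
        (L.hit (2 + i * L.n + j) u * M (L.pair u)) * x u = 0 := by
      intro u hu
      rw [Finset.mem_range] at hu
      rw [hit, if_neg (by omega), if_pos hv, if_pos hu]
      norm_num
    have hin : ∀ h : ℕ, ∑ c ∈ Finset.range (L.k * L.width),
        (L.hit (2 + i * L.n + j) (L.base + (h * (L.k * L.width) + c)) *
          M (L.pair (L.base + (h * (L.k * L.width) + c)))) *
            x (L.base + (h * (L.k * L.width) + c)) =
        (kron (h / L.profiles) i : ℝ) * ((kron (L.digit (h % L.profiles) i) j : ℝ) * M h *
          x (L.node (h * L.k + (L.k - 1)) (6 * L.R + 1))) := by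
      intro h
      have h1 : ∀ c ∈ Finset.range (L.k * L.width),
          (L.hit (2 + i * L.n + j) (L.base + (h * (L.k * L.width) + c)) *
          M (L.pair (L.base + (h * (L.k * L.width) + c)))) *
            x (L.base + (h * (L.k * L.width) + c)) =
          if c = L.k * L.width - 1 then
            (kron (h / L.profiles) i : ℝ) * ((kron (L.digit (h % L.profiles) i) j : ℝ) * M h *
              x (L.node (h * L.k + (L.k - 1)) (6 * L.R + 1))) else 0 := by
        intro c hc
        rw [Finset.mem_range] at hc
        have h2 : L.base + (h * (L.k * L.width) + c) - L.base = c + h * (L.k * L.width) := by omega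
        have h3 : L.pair (L.base + (h * (L.k * L.width) + c)) = h := by
          rw [pair, h2, Nat.add_mul_div_right _ _ hkw, Nat.div_eq_of_lt hc, zero_add]
        rw [hit, if_neg (by omega), if_pos hv, if_neg (by omega), h3, h2, hpl _ _ hj, hmod,
          Nat.add_mul_mod_self_right, Nat.mod_eq_of_lt hc]
        rw [kron]
        split_ifs with h4
        -- The last strategy among the `k` consecutive blocks of a pair is the output of the last
        -- block in its chain.
        · have h5 : L.base + (h * (L.k * L.width) + c) =
              L.node (h * L.k + (L.k - 1)) (6 * L.R + 1) := by
            obtain ⟨k', hk'⟩ : ∃ k', L.k = k' + 1 := ⟨L.k - 1, by omega⟩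
            have hw : 6 * L.R + 1 = L.width - 1 := by unfold width; omega
            have hw' := L.width_pos
            have h6 : (k' + 1) * L.width = k' * L.width + L.width := by ring
            have h7 : (h * (k' + 1) + k') * L.width = h * ((k' + 1) * L.width) + k' * L.width := by
              ring
            rw [h4, node, start, hw, hk', Nat.add_sub_cancel, h7]
            omega
          rw [h5]
          push_cast
          ring
        · simp
      rw [Finset.sum_congr rfl h1, Finset.sum_ite_eq', if_pos (Finset.mem_range.2 (by omega))]
    have hout : ∀ i' ∈ Finset.range L.k, ∑ s ∈ Finset.range L.profiles,
        (kron ((i' * L.profiles + s) / L.profiles) i : ℝ) *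
          ((kron (L.digit ((i' * L.profiles + s) % L.profiles) i) j : ℝ) *
            M (i' * L.profiles + s) *
            x (L.node ((i' * L.profiles + s) * L.k + (L.k - 1)) (6 * L.R + 1))) =
        if i' = i then ∑ s ∈ Finset.range L.profiles, (kron (L.digit s i) j : ℝ) *
          M (i * L.profiles + s) *
          x (L.node ((i * L.profiles + s) * L.k + (L.k - 1)) (6 * L.R + 1)) else 0 := by
      intro i' _
      have h1 : ∀ s ∈ Finset.range L.profiles, (i' * L.profiles + s) / L.profiles = i' ∧
          (i' * L.profiles + s) % L.profiles = s := by
        intro s hs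
        rw [Finset.mem_range] at hs
        rw [add_comm, Nat.add_mul_div_right _ _ hN, Nat.div_eq_of_lt hs, zero_add,
          Nat.add_mul_mod_self_right, Nat.mod_eq_of_lt hs]
        exact ⟨rfl, rfl⟩
      split_ifs with h
      · refine Finset.sum_congr rfl fun s hs => ?_
        rw [(h1 s hs).1, (h1 s hs).2, kron, if_pos h, h]
        push_cast; ring
      · refine Finset.sum_eq_zero fun s hs => ?_
        rw [(h1 s hs).1, kron, if_neg h]
        push_cast; ring
    rw [size, Finset.sum_range_add, Finset.sum_eq_zero hlow, zero_add,
      mul_assoc (L.k * L.profiles), sum_range_mul_eq]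
    simp only [hin]
    rw [sum_range_mul_eq, Finset.sum_congr rfl hout, Finset.sum_ite_eq',
      if_pos (Finset.mem_range.2 hi)]
  have hk0 := L.two_le_base
  rw [row, hcoef, hhit, const, if_neg (by omega), if_pos hv]
  push_cast
  ring

end rows

end Layout

/-! ### Approximate arithmetic by rectified linear gates -/

/-- The value `v ≥ 0` is, up to `η`, the positive part of `L`. -/
def IsGate (η v L : ℝ) : Prop := 0 ≤ v ∧ |v - max 0 L| ≤ η

/-- The upper bound on the row says that `v` is not much below `L`; the lower bound, available only
for `v > 0`, says that it is not much above. When `v = 0` only the first remains, which is where the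
positive part comes from. Dividing by `c ≥ 1` does not increase the error. -/
theorem IsGate.of_row {η v L c r : ℝ} (hc : 1 ≤ c) (hη : 0 ≤ η) (hv : 0 ≤ v) (hr : r = c * (L - v))
    (h₁ : r ≤ η) (h₂ : 0 < v → -η ≤ r) : IsGate η v L := by
  refine ⟨hv, ?_⟩
  have h3 : L - v ≤ η := by
    rcases le_or_gt (L - v) 0 with h | h
    · linarith
    · nlinarith
  rcases hv.eq_or_lt with h | h
  · subst h
    rw [abs_le]
    constructor
    · have : max 0 L ≤ η := max_le hη (by linarith)
      linarith
    · have : 0 ≤ max 0 L := le_max_left _ _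
      linarith
  · have h4 : -η ≤ L - v := by
      have := h₂ h
      rcases le_or_gt 0 (L - v) with h | h
      · linarith
      · nlinarith
    rw [abs_le]
    constructor
    · have : max 0 L ≤ v + η := max_le (by linarith) (by linarith)
      linarith
    · have : L ≤ max 0 L := le_max_right _ _
      linarith

theorem IsGate.le {η v L b : ℝ} (h : IsGate η v L) (hb : 0 ≤ b) (hL : L ≤ b) : v ≤ b + η := by
  have h1 := (abs_le.1 h.2).2
  have h2 : max 0 L ≤ b := max_le hb hL
  linarith

theorem IsGate.abs_sub_le {η v L w δ : ℝ} (h : IsGate η v L) (hw : 0 ≤ w) (hL : |L - w| ≤ δ) :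
    |v - w| ≤ δ + η := by
  have h1 : |max 0 L - w| ≤ |L - w| := by
    have := abs_max_sub_max_le_abs L w 0
    rwa [max_comm L, max_eq_left hw] at this
  have h2 := _root_.abs_sub_le v (max 0 L) w
  have := h.2
  linarith

/-- One application of the tent map by two gates. -/
theorem abs_sub_tent_le {η θ z a z' : ℝ} (hηθ : η ≤ θ) (hz0 : 0 ≤ z)
    (hz1 : z ≤ 1 + 3 * θ) (ha : IsGate η a (1 - 2 * z)) (hz' : IsGate η z' (2 - 2 * a - 2 * z)) :
    z' ≤ 1 + 3 * θ ∧ |z' - (1 - |2 * z - 1|)| ≤ 9 * θ := by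
  have ha2 := abs_le.1 ha.2
  have hz2 := abs_le.1 hz'.2
  -- On each linear piece of the two gates and of the absolute value the claim is linear. The bound
  -- `1 + 3 * θ` reproduces itself, so it can be iterated.
  rcases max_cases 0 (1 - 2 * z) with ⟨h1, h2⟩ | ⟨h1, h2⟩ <;> rw [h1] at ha2 <;>
  rcases max_cases 0 (2 - 2 * a - 2 * z) with ⟨h3, h4⟩ | ⟨h3, h4⟩ <;> rw [h3] at hz2 <;>
  rcases abs_cases (2 * z - 1) with ⟨h5, h6⟩ | ⟨h5, h6⟩ <;> rw [h5] <;>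
  refine ⟨by linarith, abs_le.2 ⟨by linarith, by linarith⟩⟩

/-- Squaring by iterated tent maps: `z ^ 2 = z - t / 2 + t ^ 2 / 4` for `t = 1 - |2 * z - 1|`. -/
theorem abs_sub_sq_le {R : ℕ} {η θ : ℝ} {z a S : ℕ → ℝ} (hη : 0 ≤ η) (hηθ : η ≤ θ)
    (hθ : 9 * θ ≤ 1) (hz0 : 0 ≤ z 0) (hz1 : z 0 ≤ 1 + 3 * θ)
    (ha : ∀ r, r + 1 < R → IsGate η (a r) (1 - 2 * z r))
    (hz : ∀ r, r + 1 < R → IsGate η (z (r + 1)) (2 - 2 * a r - 2 * z r))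
    (hS : ∀ r, r + 1 < R → IsGate η (S r) (z r - z (r + 1) / 2 + S (r + 1) / 4))
    (hS0 : ∀ r < R, 0 ≤ S r) (hS1 : ∀ r < R, S r ≤ 12) :
    ∀ d r, r + d + 1 = R → |S r - z r ^ 2| ≤ 21 * θ + 16 / 4 ^ d := by
  have hzb : ∀ r < R, 0 ≤ z r ∧ z r ≤ 1 + 3 * θ := by
    intro r
    induction r with
    | zero => exact fun _ => ⟨hz0, hz1⟩
    | succ r ih =>
      intro hr
      have h := ih (by omega)
      exact ⟨(hz r hr).1, (abs_sub_tent_le hηθ h.1 h.2 (ha r hr) (hz r hr)).1⟩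
  intro d
  induction d with
  | zero =>
    intro r hr
    have h1 := hzb r (by omega)
    have h2 := hS0 r (by omega)
    have h3 := hS1 r (by omega)
    -- Without any level left nothing is known about `S`; the crude bounds `0 ≤ S ≤ 12` and `z ^ 2 ≤
    -- 16 / 9` account for the constant `16`.
    rw [abs_le]
    constructor <;> nlinarith
  | succ d ih =>
    intro r hr
    have h1 := hzb r (by omega)
    have h2 := abs_sub_tent_le hηθ h1.1 h1.2 (ha r (by omega)) (hz r (by omega))
    have h3 := hzb (r + 1) (by omega)
    have h4 := ih (r + 1) (by omega)
    set t := 1 - |2 * z r - 1| with ht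
    have ht1 : t ≤ 1 := by rw [ht]; linarith [abs_nonneg (2 * z r - 1)]
    have ht0 : -(6 * θ) ≤ t := by
      rw [ht]
      rcases abs_cases (2 * z r - 1) with ⟨h5, h6⟩ | ⟨h5, h6⟩ <;> rw [h5] <;> linarith
    have hid : z r ^ 2 = z r - t / 2 + t ^ 2 / 4 := by
      have : |2 * z r - 1| ^ 2 = (2 * z r - 1) ^ 2 := sq_abs _
      rw [ht]; nlinarith
    have h5 : |z (r + 1) ^ 2 - t ^ 2| ≤ 21 * θ := by
      have : z (r + 1) ^ 2 - t ^ 2 = (z (r + 1) - t) * (z (r + 1) + t) := by ring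
      rw [this, abs_mul]
      have h6 : |z (r + 1) + t| ≤ 7 / 3 := by
        rw [abs_le]; constructor <;> linarith
      have := mul_le_mul h2.2 h6 (abs_nonneg _) (by linarith)
      linarith
    -- The error in `z (r + 1)` is measured against the tent of the actual `z r`, so errors of
    -- earlier iterates are irrelevant. It contributes `9 / 2 * θ` directly and `21 / 4 * θ` through
    -- the square, together at most `10 * θ`; with the inherited quarter and the gate error, `21 *
    -- θ` is preserved.
    have h6 : |z r - z (r + 1) / 2 + S (r + 1) / 4 - z r ^ 2| ≤
        (21 * θ + 16 / 4 ^ (d + 1 - 1)) / 4 + 10 * θ := by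
      rw [Nat.add_sub_cancel]
      generalize (16 : ℝ) / 4 ^ d = c at h4 ⊢
      have h2' := abs_le.1 h2.2
      have h4' := abs_le.1 h4
      have h5' := abs_le.1 h5
      rw [hid, abs_le]
      constructor <;> linarith
    have h7 := (hS r (by omega)).abs_sub_le (sq_nonneg (z r)) h6
    refine h7.trans ?_
    rw [Nat.add_sub_cancel, pow_succ]
    have : (16 : ℝ) / (4 ^ d * 4) = 16 / 4 ^ d / 4 := by rw [div_div]
    rw [this]
    linarith

/-- Multiplication: `x * y = ((x + y) / 2) ^ 2 - ((x - y + 1) / 2) ^ 2 + (x - y) / 2 + 1 / 4`. -/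
theorem abs_sub_mul_le {η θ e X Y z₀ z₁ S₀ S₁ c P : ℝ} (hη : 0 ≤ η) (hηθ : η ≤ θ) (hθ : 9 * θ ≤ 1)
    (hX0 : 0 ≤ X) (hX1 : X ≤ 1 + θ) (hY0 : 0 ≤ Y) (hY1 : Y ≤ 1 + θ)
    (hz₀ : IsGate η z₀ ((X + Y) / 2)) (hz₁ : IsGate η z₁ ((X - Y + 1) / 2))
    (hS₀ : |S₀ - z₀ ^ 2| ≤ e) (hS₁ : |S₁ - z₁ ^ 2| ≤ e)
    (hc : IsGate η c (1 - (S₀ - S₁ + (X - Y) / 2 + 1 / 4))) (hP : IsGate η P (1 - c)) :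
    |P - X * Y| ≤ 2 * e + 20 * θ := by
  have h0 : |z₀ - (X + Y) / 2| ≤ θ := by
    have := hz₀.abs_sub_le (w := (X + Y) / 2) (δ := 0) (by linarith) (by simp)
    linarith
  -- The `+ 1` keeps the argument essentially nonnegative: it is at least `-θ / 2`, so rectification
  -- costs little.
  have h1 : |z₁ - (X - Y + 1) / 2| ≤ 2 * θ := by
    have h := abs_le.1 hz₁.2
    rcases max_cases 0 ((X - Y + 1) / 2) with ⟨h1, h2⟩ | ⟨h1, h2⟩ <;> rw [h1] at h <;>
      exact abs_le.2 ⟨by linarith, by linarith⟩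
  have hsq : ∀ a b δ : ℝ, |a - b| ≤ δ → |b| ≤ 10 / 9 → δ ≤ 2 / 9 →
      |a ^ 2 - b ^ 2| ≤ 3 * δ := by
    intro a b δ hab hb hδ
    have : a ^ 2 - b ^ 2 = (a - b) * ((a - b) + 2 * b) := by ring
    rw [this, abs_mul]
    have h2 : |(a - b) + 2 * b| ≤ 3 := by
      have h3 := abs_add_le (a - b) (2 * b)
      rw [abs_mul, abs_two] at h3
      linarith
    have := mul_le_mul hab h2 (abs_nonneg _) ((abs_nonneg _).trans hab)
    linarith
  have h2 := hsq _ _ _ h0 (abs_le.2 ⟨by linarith, by linarith⟩) (by linarith)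
  have h3 := hsq _ _ _ h1 (abs_le.2 ⟨by linarith, by linarith⟩) (by linarith)
  have hXY : X * Y ≤ 1 + 3 * θ := by nlinarith
  have hXY0 : 0 ≤ X * Y := mul_nonneg hX0 hY0
  have hid : X * Y = ((X + Y) / 2) ^ 2 - ((X - Y + 1) / 2) ^ 2 + (X - Y) / 2 + 1 / 4 := by ring
  set A := ((X + Y) / 2) ^ 2
  set A' := ((X - Y + 1) / 2) ^ 2
  have hL : |S₀ - S₁ + (X - Y) / 2 + 1 / 4 - X * Y| ≤ 2 * e + 9 * θ := by
    rw [hid]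
    have h2 := abs_le.1 h2
    have h3 := abs_le.1 h3
    have h4 := abs_le.1 hS₀
    have h5 := abs_le.1 hS₁
    exact abs_le.2 ⟨by linarith, by linarith⟩
  generalize S₀ - S₁ + (X - Y) / 2 + 1 / 4 = L at hc hL
  have hL := abs_le.1 hL
  have hc2 := abs_le.1 hc.2
  have hP2 := abs_le.1 hP.2
  have he : 0 ≤ e := (abs_nonneg _).trans hS₀
  generalize X * Y = W at *
  -- The gates `c` and `P` clip to `[0, 1]` up to gate error. Clipping does little harm because the
  -- product lies in `[0, 1 + 3 * θ]`.
  rcases max_cases 0 (1 - L) with ⟨h1, h2⟩ | ⟨h1, h2⟩ <;> rw [h1] at hc2 <;>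
  rcases max_cases 0 (1 - c) with ⟨h3, h4⟩ | ⟨h3, h4⟩ <;> rw [h3] at hP2 <;>
  exact abs_le.2 ⟨by linarith, by linarith⟩

/-- Errors of repeated multiplication add up. -/
theorem abs_sub_prod_le {k : ℕ} {δ θ : ℝ} {X Y y : ℕ → ℝ} (hθ0 : 0 ≤ θ) (hθ : θ ≤ 1)
    (hX0 : |X 0 - 1| ≤ θ) (hX : ∀ l < k, |X l| ≤ 1 + θ) (hy0 : ∀ l < k, 0 ≤ y l)
    (hy1 : ∀ l < k, y l ≤ 1)
    (hY : ∀ l < k, |Y l - y l| ≤ θ) (hXY : ∀ l < k, |X (l + 1) - X l * Y l| ≤ δ) :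
    ∀ l ≤ k, |X l - ∏ l' ∈ Finset.range l, y l'| ≤ θ + l * (δ + 2 * θ) := by
  intro l
  induction l with
  | zero => intro _; simpa using hX0
  | succ l ih =>
    intro hl
    have h1 := ih (by omega)
    have h2 := hXY l (by omega)
    rw [Finset.prod_range_succ]
    set Q := ∏ l' ∈ Finset.range l, y l'
    have h3 : |X l * (Y l - y l)| ≤ 2 * θ := by
      rw [abs_mul]
      have := mul_le_mul (hX l (by omega)) (hY l (by omega)) (abs_nonneg _) (by linarith)
      nlinarith
    have h4 : |(X l - Q) * y l| ≤ |X l - Q| := by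
      rw [abs_mul, abs_of_nonneg (hy0 l (by omega))]
      exact mul_le_of_le_one_right (abs_nonneg _) (hy1 l (by omega))
    -- Telescoping: the error of the multiplication, the error of the factor, and the inherited
    -- error multiplied by a number in `[0, 1]`, hence not amplified.
    have h5 : X (l + 1) - Q * y l =
        (X (l + 1) - X l * Y l) + X l * (Y l - y l) + (X l - Q) * y l := by ring
    rw [h5]
    have h6 := abs_add_three (X (l + 1) - X l * Y l) (X l * (Y l - y l)) ((X l - Q) * y l)
    push_cast
    linarith

/-! ### Analysis of the equilibria of the layout -/

namespace Layout

/-- `x` are the weights, scaled to total weight `D`, of a strategy all of whose pure strategies are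
`η`-best responses to itself. -/
structure IsEquilibrium (L : Layout) (M x : ℕ → ℝ) (D η : ℝ) : Prop where
  nonneg : ∀ u, 0 ≤ x u
  eq_zero : ∀ u, L.size ≤ u → x u = 0
  sum_eq : ∑ u ∈ Finset.range L.size, x u = D
  row_le : ∀ u < L.size, 0 < x u → ∀ v < L.size, L.row M x D v ≤ L.row M x D u + η
  payoff_nonneg : ∀ h < L.k * L.profiles, 0 ≤ M h
  payoff_le_one : ∀ h < L.k * L.profiles, M h ≤ 1
  k_pos : 0 < L.k
  n_pos : 0 < L.n
  R_pos : 0 < L.R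
  error_nonneg : 0 ≤ η
  error_le : 100 * η ≤ 1
  profiles_le : 100 * (L.profiles : ℝ) ≤ D
  size_lt : 8 * (L.size : ℝ) < D

theorem player_lt_size {L : Layout} {i j : ℕ} (hi : i < L.k) (hj : j < L.n) :
    2 + i * L.n + j < L.size := by
  have : (i + 1) * L.n ≤ L.k * L.n := Nat.mul_le_mul_right _ hi
  unfold size base
  nlinarith [Nat.zero_le (L.k * L.profiles * L.k * L.width)]

theorem size_pos (L : Layout) : 0 < L.size := by
  have := L.two_le_base
  unfold size; omega

theorem one_lt_size (L : Layout) : 1 < L.size := by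
  have := L.two_le_base
  unfold size; omega

theorem last_lt {L : Layout} {i s : ℕ} (hi : i < L.k) (hs : s < L.profiles) {l : ℕ} (hl : l < L.k) :
    (i * L.profiles + s) * L.k + l < L.k * L.profiles * L.k := by
  have h1 : (i + 1) * L.profiles ≤ L.k * L.profiles := Nat.mul_le_mul_right _ hi
  have h2 : (i * L.profiles + s + 1) * L.k ≤ L.k * L.profiles * L.k :=
    Nat.mul_le_mul_right _ (by nlinarith)
  nlinarith

theorem pair_lt {L : Layout} {i s : ℕ} (hi : i < L.k) (hs : s < L.profiles) :
    i * L.profiles + s < L.k * L.profiles := by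
  have h1 : (i + 1) * L.profiles ≤ L.k * L.profiles := Nat.mul_le_mul_right _ hi
  nlinarith

namespace IsEquilibrium

variable {L : Layout} {M x : ℕ → ℝ} {D η : ℝ} (hE : L.IsEquilibrium M x D η)
include hE

/-- Comparison with strategy `0`, whose row is zero. It does not need `0` to be in the support, so
it is available for the a priori bounds. -/
theorem neg_error_le_row {v : ℕ} (hv : v < L.size) (h : 0 < x v) : -η ≤ L.row M x D v := by
  have := hE.row_le v hv h 0 L.size_pos
  rw [row_zero] at this
  linarith

/-- The upper half of a gate. It follows from `neg_error_le_row` alone and thus can be used before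
`zero_pos`. -/
theorem le_of_row {v : ℕ} {c A b : ℝ} (hv : v < L.size) (hr : L.row M x D v = c * (A - x v))
    (hc : 1 ≤ c) (hb : 0 ≤ b) (hA : A ≤ b) : x v ≤ b + η := by
  have hη := hE.error_nonneg
  rcases (hE.nonneg v).eq_or_lt with h | h
  · linarith
  · have h1 := hE.neg_error_le_row hv h
    rw [hr] at h1
    rcases le_or_gt 0 (A - x v) with h2 | h2
    · linarith
    · nlinarith

theorem one_le : x 1 ≤ 1 + η :=
  hE.le_of_row (c := 1) (A := 1) L.one_lt_size (by rw [row_one hE.eq_zero]; ring) le_rfl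
    zero_le_one le_rfl

/-- The bound holds whatever the inputs of the block are, thanks to the clipping; this prevents
growth along the chains. -/
theorem output_le {b : ℕ} (hb : b < L.k * L.profiles * L.k) :
    x (L.node b (6 * L.R + 1)) ≤ 1 + η :=
  hE.le_of_row (node_lt_size hb (by unfold width; omega)) (row_output hE.eq_zero) le_rfl zero_le_one
    (by linarith [hE.nonneg (L.node b (6 * L.R))])

theorem profiles_pos : 0 < L.profiles := Nat.pow_pos hE.n_pos

theorem D_pos : 0 < D := by
  have h1 := hE.profiles_le
  have h2 : (0 : ℝ) < L.profiles := by exact_mod_cast hE.profiles_pos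
  linarith

/-- The scaled expected payoff of a strategy of an original player is small. -/
theorem bonus_mem {i : ℕ} (hi : i < L.k) (j : ℕ) :
    0 ≤ (∑ s ∈ Finset.range L.profiles, (kron (L.digit s i) j : ℝ) * M (i * L.profiles + s) *
          x (L.node ((i * L.profiles + s) * L.k + (L.k - 1)) (6 * L.R + 1))) / D ∧
    (∑ s ∈ Finset.range L.profiles, (kron (L.digit s i) j : ℝ) * M (i * L.profiles + s) *
          x (L.node ((i * L.profiles + s) * L.k + (L.k - 1)) (6 * L.R + 1))) / D ≤
      3 * L.profiles / D := by
  have hD := hE.D_pos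
  have hk := hE.k_pos
  constructor
  · refine div_nonneg (Finset.sum_nonneg fun s hs => ?_) hD.le
    exact mul_nonneg (mul_nonneg (Nat.cast_nonneg _)
      (hE.payoff_nonneg _ (pair_lt hi (Finset.mem_range.1 hs)))) (hE.nonneg _)
  · refine div_le_div_of_nonneg_right ?_ hD.le
    have h1 : ∀ s ∈ Finset.range L.profiles, (kron (L.digit s i) j : ℝ) *
        M (i * L.profiles + s) *
          x (L.node ((i * L.profiles + s) * L.k + (L.k - 1)) (6 * L.R + 1)) ≤ 3 := by
      intro s hs
      have hs := Finset.mem_range.1 hs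
      have h2 := hE.payoff_nonneg _ (pair_lt hi hs)
      have h3 := hE.payoff_le_one _ (pair_lt hi hs)
      have h4 := hE.output_le (last_lt hi hs (l := L.k - 1) (by omega))
      have h5 : (kron (L.digit s i) j : ℝ) ≤ 1 := by exact_mod_cast kron_le_one _ _
      have h6 : (kron (L.digit s i) j : ℝ) * M (i * L.profiles + s) ≤ 1 :=
        mul_le_one₀ h5 h2 h3
      have h7 := mul_le_mul h6 h4 (hE.nonneg _) zero_le_one
      have := hE.error_le
      linarith
    have := Finset.sum_le_sum h1
    rw [Finset.sum_const, Finset.card_range, nsmul_eq_mul] at this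
    linarith

theorem bonus_le : 3 * (L.profiles : ℝ) / D ≤ 3 / 100 := by
  have hD := hE.D_pos
  rw [div_le_div_iff₀ hD (by norm_num)]
  linarith [hE.profiles_le]

/-- A used strategy of player `i` has row at least `-η`, and its payoff term is at most `3 *
L.profiles / D`. -/
theorem weight_le {i j : ℕ} (hi : i < L.k) (hj : j < L.n) (h : 0 < x (2 + i * L.n + j)) :
    ∑ j' ∈ Finset.range L.n, x (2 + i * L.n + j') ≤ 1 + 3 * L.profiles / D + η := by
  have h1 := hE.neg_error_le_row (player_lt_size hi hj) h
  rw [row_player hi hj] at h1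
  have h2 := (hE.bonus_mem hi j).2
  linarith

theorem player_le_weight {i j : ℕ} (hj : j < L.n) :
    x (2 + i * L.n + j) ≤ ∑ j' ∈ Finset.range L.n, x (2 + i * L.n + j') :=
  Finset.single_le_sum (f := fun j' => x (2 + i * L.n + j')) (fun _ _ => hE.nonneg _)
    (Finset.mem_range.2 hj)

theorem player_le {i j : ℕ} (hi : i < L.k) (hj : j < L.n) :
    x (2 + i * L.n + j) ≤ 1 + 3 * L.profiles / D + η := by
  rcases (hE.nonneg (2 + i * L.n + j)).eq_or_lt with h | h
  · rw [← h]
    have : 0 ≤ 3 * (L.profiles : ℝ) / D := div_nonneg (by positivity) hE.D_pos.le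
    linarith [hE.error_nonneg]
  · exact (hE.player_le_weight hj).trans (hE.weight_le hi hj h)

theorem digit_lt (s i : ℕ) : L.digit s i < L.n := Nat.mod_lt _ hE.n_pos

omit hE in
theorem left_eq {b : ℕ} (h : b % L.k ≠ 0) : L.left b = L.node (b - 1) (6 * L.R + 1) := by
  obtain ⟨c, rfl⟩ : ∃ c, b = c + 1 := ⟨b - 1, by
    have : b ≠ 0 := fun h' => h (by simp [h'])
    omega⟩
  rw [left, if_neg h, node, start, Nat.add_sub_cancel, Nat.succ_mul]
  unfold width
  omega

theorem left_le {b : ℕ} (hb : b < L.k * L.profiles * L.k) :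
    x (L.left b) ≤ 1 + 3 * L.profiles / D + η := by
  have : 0 ≤ 3 * (L.profiles : ℝ) / D := div_nonneg (by positivity) hE.D_pos.le
  by_cases h : b % L.k = 0
  · rw [left, if_pos h]
    linarith [hE.one_le]
  · rw [left_eq h]
    have := hE.output_le (b := b - 1) (by omega)
    linarith

theorem right_le (b : ℕ) : x (L.right b) ≤ 1 + 3 * L.profiles / D + η := by
  have : 0 ≤ 3 * (L.profiles : ℝ) / D := div_nonneg (by positivity) hE.D_pos.le
  rw [right]
  split_ifs
  · linarith [hE.one_le]
  · exact hE.player_le (Nat.mod_lt _ hE.k_pos) (hE.digit_lt _ _)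

/-- The squares (offset `2` modulo `3`) are excluded because only they refer to a later level; all
other gates are bounded directly by their affine argument. -/
theorem node_le_of_ne {b o : ℕ} (hb : b < L.k * L.profiles * L.k) (ho : o < 6 * L.R)
    (ho' : o % 3 ≠ 2) : x (L.node b o) ≤ 3 := by
  have hw : o < L.width := by unfold width; omega
  have hlt := node_lt_size hb hw
  have hη := hE.error_le
  have hl := hE.left_le hb
  have hr := hE.right_le b
  have hb := hE.bonus_le
  have hr0 := hE.nonneg (L.right b)
  by_cases h1 : o % 3 = 1
  · have := hE.le_of_row hlt (row_kink hE.eq_zero ho h1) le_rfl zero_le_one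
      (by linarith [hE.nonneg (L.node b (o - 1))])
    linarith
  by_cases h2 : o = 0
  · subst h2
    have := hE.le_of_row (b := 2) hlt (row_mean hE.eq_zero hE.R_pos) one_le_two zero_le_two
      (by linarith)
    linarith
  by_cases h3 : o = 3
  · subst h3
    have := hE.le_of_row (b := 2) hlt (row_diff hE.eq_zero hE.R_pos) one_le_two zero_le_two
      (by linarith)
    linarith
  · have := hE.le_of_row (b := 2) hlt (row_tent hE.eq_zero ho (by omega) (by omega)) le_rfl
      zero_le_two
      (by linarith [hE.nonneg (L.node b (o - 5)), hE.nonneg (L.node b (o - 6))])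
    linarith

theorem square_le {b : ℕ} (hb : b < L.k * L.profiles * L.k) (d : ℕ) :
    ∀ o, o < 6 * L.R → o % 3 = 2 → 6 * L.R ≤ o + d → x (L.node b o) ≤ 5 := by
  induction d with
  | zero => intro o h1 _ h3; omega
  | succ d ih =>
    intro o ho ho' hd
    have hw : o < L.width := by unfold width; omega
    have h1 := hE.node_le_of_ne hb (o := o - 2) (by omega) (by omega)
    have h2 : x (L.node b (o + 6)) ≤ 5 := by
      rcases lt_or_ge (o + 6) (6 * L.R) with h | h
      · exact ih _ h (by omega) (by omega)
      -- At the last level `o + 6` lands in the next block at offset `0` or `3`, which holds an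
      -- iterate and is bounded by `node_le_of_ne`; after the last block the weight is `0`.
      · have h3 : L.node b (o + 6) = L.node (b + 1) (o + 4 - 6 * L.R) := by
          have h4 : (b + 1) * L.width = b * L.width + (6 * L.R + 2) := Nat.succ_mul _ _
          unfold node start
          omega
        rw [h3]
        rcases lt_or_ge (b + 1) (L.k * L.profiles * L.k) with h4 | h4
        · have hR := hE.R_pos
          have := hE.node_le_of_ne h4 (o := o + 4 - 6 * L.R) (by omega) (by omega)
          linarith
        · rw [hE.eq_zero]
          · norm_num
          · have := Nat.mul_le_mul_right L.width h4
            unfold size node start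
            omega
    have := hE.le_of_row (b := 3 + 5 / 4) (node_lt_size hb hw) (row_square hE.eq_zero ho ho')
      (by norm_num) (by norm_num) (by linarith [hE.nonneg (L.node b (o + 4))])
    linarith [hE.error_le]

theorem le_eight {u : ℕ} (hu : u < L.size) (hu0 : u ≠ 0) : x u ≤ 8 := by
  have hη := hE.error_le
  have hbo := hE.bonus_le
  have hR := hE.R_pos
  rcases lt_or_ge u L.base with h | h
  · rcases lt_or_ge u 2 with h2 | h2
    · obtain rfl : u = 1 := by omega
      linarith [hE.one_le]
    · have h3 : u = 2 + (u - 2) / L.n * L.n + (u - 2) % L.n := by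
        have := Nat.mod_add_div (u - 2) L.n
        rw [mul_comm] at this
        omega
      rw [h3]
      have := hE.player_le (i := (u - 2) / L.n) (j := (u - 2) % L.n)
        (by rw [Nat.div_lt_iff_lt_mul hE.n_pos]; unfold base at h; omega) (Nat.mod_lt _ hE.n_pos)
      linarith
  · obtain ⟨b, o, hb, ho, rfl⟩ := exists_node_eq h hu
    by_cases h1 : o < 6 * L.R
    · by_cases h2 : o % 3 = 2
      · linarith [hE.square_le hb (6 * L.R) o h1 h2 (by omega)]
      · linarith [hE.node_le_of_ne hb h1 h2]
    by_cases h2 : o = 6 * L.R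
    · subst h2
      have h3 := hE.square_le hb (6 * L.R) 5 (by omega) (by norm_num) (by omega)
      have h4 := hE.right_le b
      have := hE.le_of_row (b := 7) hu (row_complement hE.eq_zero) (by norm_num) (by norm_num)
        (by linarith [hE.nonneg (L.node b 2), hE.nonneg (L.left b)])
      linarith
    · obtain rfl : o = 6 * L.R + 1 := by unfold width at ho; omega
      linarith [hE.output_le hb]

/-- The strategy with zero payoff is in the support. -/
theorem zero_pos : 0 < x 0 := by
  by_contra h
  have h0 : x 0 = 0 := le_antisymm (not_lt.1 h) (hE.nonneg 0)
  have h1 : ∀ u ∈ Finset.range L.size, x u ≤ 8 := by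
    intro u hu
    by_cases h : u = 0
    · rw [h, h0]; norm_num
    · exact hE.le_eight (Finset.mem_range.1 hu) h
  have h2 := Finset.sum_le_sum h1
  -- If strategy `0` were unused, the total weight `D` would be at most `8 * L.size`.
  rw [hE.sum_eq, Finset.sum_const, Finset.card_range, nsmul_eq_mul] at h2
  linarith [hE.size_lt]

/-- Strategy `0` is used and has row zero, so no row exceeds it by more than `η`. From here on all
gates are two-sided. -/
theorem row_le_error {v : ℕ} (hv : v < L.size) : L.row M x D v ≤ η := by
  have := hE.row_le 0 L.size_pos hE.zero_pos v hv
  rw [row_zero] at this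
  linarith

theorem isGate {v : ℕ} {c A : ℝ} (hv : v < L.size) (hr : L.row M x D v = c * (A - x v))
    (hc : 1 ≤ c) : IsGate η (x v) A :=
  .of_row hc hE.error_nonneg (hE.nonneg v) hr (hE.row_le_error hv) (hE.neg_error_le_row hv)

/-- The multiplication lemma for gates with squaring error `21 * θ + 16 / 4 ^ (R - 1)`, which enters
twice: `2 * 21 + 20 = 62` and `2 * 16 = 32`. -/
theorem abs_sub_mul_le {b : ℕ} (hb : b < L.k * L.profiles * L.k) :
    |x (L.node b (6 * L.R + 1)) - x (L.left b) * x (L.right b)| ≤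
      62 * (3 * L.profiles / D + η) + 32 / 4 ^ (L.R - 1) := by
  have hR := hE.R_pos
  have hbo : 0 ≤ 3 * (L.profiles : ℝ) / D := div_nonneg (by positivity) hE.D_pos.le
  have hbo' := hE.bonus_le
  have hη := hE.error_le
  have hη0 := hE.error_nonneg
  have hl := hE.left_le hb
  have hr := hE.right_le b
  have hl0 := hE.nonneg (L.left b)
  have hr0 := hE.nonneg (L.right b)
  set θ := 3 * (L.profiles : ℝ) / D + η with hθ
  have hηθ : η ≤ θ := by linarith
  have hθ9 : 9 * θ ≤ 1 := by linarith
  have hlt : ∀ o, o < 6 * L.R + 2 → L.node b o < L.size := fun o ho => node_lt_size hb ho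
  have hz₀ := hE.isGate (hlt 0 (by omega)) (row_mean hE.eq_zero hR) one_le_two
  have hz₁ := hE.isGate (hlt 3 (by omega)) (row_diff hE.eq_zero hR) one_le_two
  -- Both squaring circuits at once: `σ = 0` squares the mean of the factors, `σ = 1` their shifted
  -- difference.
  have hsq : ∀ σ < 2, x (L.node b (3 * σ)) ≤ 1 + 3 * θ →
      |x (L.node b (3 * σ + 2)) - x (L.node b (3 * σ)) ^ 2| ≤ 21 * θ + 16 / 4 ^ (L.R - 1) := by
    intro σ hσ hz
    have := abs_sub_sq_le (R := L.R) (η := η) (θ := θ)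
      (z := fun r => x (L.node b (6 * r + 3 * σ)))
      (a := fun r => x (L.node b (6 * r + 3 * σ + 1)))
      (S := fun r => x (L.node b (6 * r + 3 * σ + 2))) hη0 hηθ hθ9
      (hE.nonneg _) (by simpa using hz)
      (fun r hr => hE.isGate (hlt _ (by omega)) (row_kink hE.eq_zero (by omega) (by omega)) le_rfl)
      (fun r hr => by
        have := hE.isGate (hlt (6 * (r + 1) + 3 * σ) (by omega))
          (row_tent hE.eq_zero (by omega) (by omega) (by omega)) le_rfl
        rwa [show 6 * (r + 1) + 3 * σ - 5 = 6 * r + 3 * σ + 1 by omega,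
          show 6 * (r + 1) + 3 * σ - 6 = 6 * r + 3 * σ by omega] at this)
      (fun r hr => by
        have := hE.isGate (hlt (6 * r + 3 * σ + 2) (by omega))
          (row_square hE.eq_zero (by omega) (by omega)) (by norm_num)
        rwa [show 6 * r + 3 * σ + 2 - 2 = 6 * r + 3 * σ by omega,
          show 6 * r + 3 * σ + 2 + 4 = 6 * (r + 1) + 3 * σ by omega,
          show 6 * r + 3 * σ + 2 + 6 = 6 * (r + 1) + 3 * σ + 2 by omega] at this)
      (fun r _ => hE.nonneg _)
      (fun r hr => by
        have := hE.square_le hb (6 * L.R) (6 * r + 3 * σ + 2) (by omega) (by omega) (by omega)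
        linarith)
      (L.R - 1) 0 (by omega)
    simpa using this
  have h0 := hsq 0 (by norm_num) (by
    have := hz₀.le (b := 1 + θ) (by linarith) (by linarith)
    simp only [mul_zero]
    linarith)
  have h1 := hsq 1 (by norm_num) (by
    have := hz₁.le (b := 1 + θ) (by linarith) (by linarith)
    simp only [mul_one]
    linarith)
  have := _root_.abs_sub_mul_le hη0 hηθ hθ9 hl0 (by linarith) hr0 (by linarith) hz₀ hz₁ h0 h1
    (hE.isGate (hlt (6 * L.R) (by omega)) (row_complement hE.eq_zero) (by norm_num))
    (hE.isGate (hlt (6 * L.R + 1) (by omega)) (row_output hE.eq_zero) le_rfl)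
  refine this.trans (le_of_eq ?_)
  ring

theorem abs_one_sub_le : |x 1 - 1| ≤ η := by
  have := hE.isGate (c := 1) (A := 1) L.one_lt_size (by rw [row_one hE.eq_zero]; ring) le_rfl
  simpa using this.2

theorem le_weight {i : ℕ} (hi : i < L.k) :
    1 - η ≤ ∑ j' ∈ Finset.range L.n, x (2 + i * L.n + j') := by
  have h1 := hE.row_le_error (player_lt_size hi hE.n_pos)
  rw [row_player hi hE.n_pos] at h1
  have h2 := (hE.bonus_mem hi 0).1
  linarith

theorem weight_pos {i : ℕ} (hi : i < L.k) :
    0 < ∑ j' ∈ Finset.range L.n, x (2 + i * L.n + j') := by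
  linarith [hE.le_weight hi, hE.error_le]

/-- The total weight is positive, so some strategy of player `i` is used and `weight_le` applies to
it. -/
theorem weight_le' {i : ℕ} (hi : i < L.k) :
    ∑ j' ∈ Finset.range L.n, x (2 + i * L.n + j') ≤ 1 + 3 * L.profiles / D + η := by
  obtain ⟨j, hj, hj'⟩ := Finset.exists_lt_of_sum_lt (s := Finset.range L.n) (f := fun _ => (0 : ℝ))
    (g := fun j' => x (2 + i * L.n + j')) (by simpa using hE.weight_pos hi)
  exact hE.weight_le hi (Finset.mem_range.1 hj) hj'

omit hE in
/-- The mixed strategies that the weights induce for the original players. -/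
noncomputable def _root_.Layout.profile (L : Layout) (x : ℕ → ℝ) (i j : ℕ) : ℝ :=
  x (2 + i * L.n + j) / ∑ j' ∈ Finset.range L.n, x (2 + i * L.n + j')

theorem profile_nonneg (i j : ℕ) : 0 ≤ L.profile x i j :=
  div_nonneg (hE.nonneg _) (Finset.sum_nonneg fun _ _ => hE.nonneg _)

theorem profile_le_one {i j : ℕ} (hi : i < L.k) (hj : j < L.n) : L.profile x i j ≤ 1 :=
  (div_le_one (hE.weight_pos hi)).2 (hE.player_le_weight hj)

/-- Normalization divides by a total weight that is within `θ` of `1`, and the quotient is at most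
`1`. -/
theorem abs_sub_profile_le {i j : ℕ} (hi : i < L.k) (hj : j < L.n) :
    |x (2 + i * L.n + j) - L.profile x i j| ≤ 3 * L.profiles / D + η := by
  have h0 := hE.weight_pos hi
  have h1 := hE.le_weight hi
  have h2 := hE.weight_le' hi
  have h3 := hE.profile_nonneg i j
  have h4 := hE.profile_le_one hi hj
  have hbo : 0 ≤ 3 * (L.profiles : ℝ) / D := div_nonneg (by positivity) hE.D_pos.le
  have h5 : x (2 + i * L.n + j) =
      L.profile x i j * ∑ j' ∈ Finset.range L.n, x (2 + i * L.n + j') :=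
    (div_mul_cancel₀ _ h0.ne').symm
  set w := ∑ j' ∈ Finset.range L.n, x (2 + i * L.n + j')
  rw [h5, show L.profile x i j * w - L.profile x i j = L.profile x i j * (w - 1) by ring, abs_mul,
    abs_of_nonneg h3]
  have h6 : |w - 1| ≤ 3 * L.profiles / D + η := abs_le.2 ⟨by linarith, by linarith⟩
  exact (mul_le_of_le_one_left (abs_nonneg _) h4).trans h6

/-- Every block chain computes, approximately, the probability of a profile of the others. -/
theorem abs_sub_prod_le {i s : ℕ} (hi : i < L.k) (hs : s < L.profiles) :
    |x (L.node ((i * L.profiles + s) * L.k + (L.k - 1)) (6 * L.R + 1)) -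
      ∏ l ∈ Finset.range L.k, (if l = i then 1 else L.profile x l (L.digit s l))| ≤
    L.k * (65 * (3 * L.profiles / D + η) + 32 / 4 ^ (L.R - 1)) := by
  have hk := hE.k_pos
  have hbo : 0 ≤ 3 * (L.profiles : ℝ) / D := div_nonneg (by positivity) hE.D_pos.le
  have hbo' := hE.bonus_le
  have hη := hE.error_le
  have hη0 := hE.error_nonneg
  have hN := hE.profiles_pos
  set θ := 3 * (L.profiles : ℝ) / D + η with hθ
  set h := i * L.profiles + s with hh
  have hb : ∀ l < L.k, h * L.k + l < L.k * L.profiles * L.k := fun l hl => last_lt hi hs hl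
  have hmod : ∀ l < L.k, (h * L.k + l) % L.k = l := fun l hl => by
    rw [add_comm, Nat.add_mul_mod_self_right, Nat.mod_eq_of_lt hl]
  have hdiv : ∀ l < L.k, (h * L.k + l) / L.k = h := fun l hl => by
    rw [add_comm, Nat.add_mul_div_right _ _ hk, Nat.div_eq_of_lt hl, zero_add]
  have hhN : h / L.profiles = i := by
    rw [hh, add_comm, Nat.add_mul_div_right _ _ hN, Nat.div_eq_of_lt hs, zero_add]
  have hhN' : h % L.profiles = s := by
    rw [hh, add_comm, Nat.add_mul_mod_self_right, Nat.mod_eq_of_lt hs]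
  have hright : ∀ l < L.k, L.right (h * L.k + l) =
      if l = i then 1 else 2 + l * L.n + L.digit s l := fun l hl => by
    rw [right, hmod l hl, hdiv l hl, hhN, hhN']
  have hleft : ∀ l, l + 1 < L.k →
      L.left (h * L.k + (l + 1)) = L.node (h * L.k + l) (6 * L.R + 1) := fun l hl => by
    rw [left_eq (by rw [hmod _ hl]; omega)]
    rfl
  -- `X l` is the partial product over the players before `l`, starting from the weight of the
  -- constant one. The place of player `i` itself contributes the factor `1`. Per block `62 * θ + 2
  -- * θ`, plus the initial `θ`, gives `65 * θ` per player.
  have main := _root_.abs_sub_prod_le (k := L.k) (δ := 62 * θ + 32 / 4 ^ (L.R - 1)) (θ := θ)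
    (X := fun l => if l = 0 then x 1 else x (L.node (h * L.k + (l - 1)) (6 * L.R + 1)))
    (Y := fun l => x (L.right (h * L.k + l)))
    (y := fun l => if l = i then 1 else L.profile x l (L.digit s l))
    (by linarith) (by linarith) (by
      simp only [if_true]
      linarith [hE.abs_one_sub_le])
    (fun l hl => by
      split_ifs with h0
      · rw [abs_of_nonneg (hE.nonneg _)]
        linarith [hE.one_le]
      · rw [abs_of_nonneg (hE.nonneg _)]
        have := hE.output_le (hb (l - 1) (by omega))
        linarith)
    (fun l hl => by
      split_ifs
      · exact zero_le_one
      · exact hE.profile_nonneg _ _)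
    (fun l hl => by
      split_ifs
      · exact le_rfl
      · exact hE.profile_le_one hl (hE.digit_lt _ _))
    (fun l hl => by
      rw [hright l hl]
      split_ifs
      · linarith [hE.abs_one_sub_le]
      · exact hE.abs_sub_profile_le hl (hE.digit_lt _ _))
    (fun l hl => by
      have h1 := hE.abs_sub_mul_le (hb l hl)
      have h2 : x (L.left (h * L.k + l)) =
          if l = 0 then x 1 else x (L.node (h * L.k + (l - 1)) (6 * L.R + 1)) := by
        split_ifs with h0
        · rw [left, if_pos (by rw [hmod l hl, h0])]
        · obtain ⟨l', rfl⟩ : ∃ l', l = l' + 1 := ⟨l - 1, by omega⟩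
          rw [hleft l' hl, Nat.add_sub_cancel]
      rw [if_neg (Nat.succ_ne_zero l), Nat.add_sub_cancel, ← h2]
      exact h1)
    L.k le_rfl
  rw [if_neg hk.ne'] at main
  refine main.trans ?_
  have hk1 : (1 : ℝ) ≤ L.k := by exact_mod_cast hk
  nlinarith

/-- Expected payoff for strategy `j` of player `i` in the profile induced by the weights. -/
noncomputable def _root_.Layout.payoff (L : Layout) (M x : ℕ → ℝ) (i j : ℕ) : ℝ :=
  ∑ s ∈ Finset.range L.profiles, (kron (L.digit s i) j : ℝ) * M (i * L.profiles + s) *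
    ∏ l ∈ Finset.range L.k, (if l = i then 1 else L.profile x l (L.digit s l))

/-- Rows of the same player share the term for the total weight, so comparing them compares payoffs
divided by `D`. Multiplying by `D` turns `η` into `D * η`; the circuit error enters once for `j` and
once for `j'`. -/
theorem payoff_le {i j j' : ℕ} (hi : i < L.k) (hj : j < L.n) (hj' : j' < L.n)
    (hpos : 0 < x (2 + i * L.n + j)) :
    L.payoff M x i j' ≤ L.payoff M x i j + (D * η +
      2 * (L.profiles * (L.k * (65 * (3 * L.profiles / D + η) + 32 / 4 ^ (L.R - 1))))) := by
  have hD := hE.D_pos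
  set δ := L.k * (65 * (3 * L.profiles / D + η) + 32 / 4 ^ (L.R - 1)) with hδ
  have happ : ∀ j, |(∑ s ∈ Finset.range L.profiles, (kron (L.digit s i) j : ℝ) *
      M (i * L.profiles + s) *
        x (L.node ((i * L.profiles + s) * L.k + (L.k - 1)) (6 * L.R + 1))) -
      L.payoff M x i j| ≤ L.profiles * δ := by
    intro j
    rw [payoff, ← Finset.sum_sub_distrib]
    refine (Finset.abs_sum_le_sum_abs _ _).trans ?_
    have h1 : ∀ s ∈ Finset.range L.profiles, |(kron (L.digit s i) j : ℝ) *
        M (i * L.profiles + s) *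
          x (L.node ((i * L.profiles + s) * L.k + (L.k - 1)) (6 * L.R + 1)) -
        (kron (L.digit s i) j : ℝ) * M (i * L.profiles + s) *
          ∏ l ∈ Finset.range L.k, (if l = i then 1 else L.profile x l (L.digit s l))| ≤ δ := by
      intro s hs
      have hs := Finset.mem_range.1 hs
      rw [← mul_sub, abs_mul]
      have h2 := hE.payoff_nonneg _ (pair_lt hi hs)
      have h3 := hE.payoff_le_one _ (pair_lt hi hs)
      have h5 : (kron (L.digit s i) j : ℝ) ≤ 1 := by exact_mod_cast kron_le_one _ _
      have h6 : (kron (L.digit s i) j : ℝ) * M (i * L.profiles + s) ≤ 1 :=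
        mul_le_one₀ h5 h2 h3
      rw [abs_of_nonneg (mul_nonneg (Nat.cast_nonneg _) h2)]
      exact (mul_le_of_le_one_left (abs_nonneg _) h6).trans (hE.abs_sub_prod_le hi hs)
    have := Finset.sum_le_sum h1
    rwa [Finset.sum_const, Finset.card_range, nsmul_eq_mul] at this
  have h1 := hE.row_le _ (player_lt_size hi hj) hpos _ (player_lt_size hi hj')
  rw [row_player hi hj, row_player hi hj'] at h1
  have h2 := abs_le.1 (happ j)
  have h3 := abs_le.1 (happ j')
  set A := ∑ s ∈ Finset.range L.profiles, (kron (L.digit s i) j : ℝ) *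
      M (i * L.profiles + s) *
        x (L.node ((i * L.profiles + s) * L.k + (L.k - 1)) (6 * L.R + 1))
  set A' := ∑ s ∈ Finset.range L.profiles, (kron (L.digit s i) j' : ℝ) *
      M (i * L.profiles + s) *
        x (L.node ((i * L.profiles + s) * L.k + (L.k - 1)) (6 * L.R + 1))
  have h4 : A' / D ≤ A / D + η := by linarith
  have h5 : A' ≤ A + D * η := by
    rw [div_add' _ _ _ hD.ne', div_le_div_iff_of_pos_right hD] at h4
    linarith
  linarith

end IsEquilibrium

end Layout

/-! ### The two-player game -/

namespace NormalFormGame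

theorem expectedPayoff_two_zero {n : ℕ} (G : NormalFormGame 2 n) (q : Fin 2 → Fin n → ℝ)
    (j : Fin n) :
    G.expectedPayoff q 0 j = ∑ j', (G.payoff 0 ![j, j'] : ℝ) * q 1 j' := by
  rw [expectedPayoff]
  refine Finset.sum_bij' (fun s _ => s 1) (fun j' _ => ![j, j']) (by simp) (by simp) ?_ (by simp) ?_
  · intro s hs
    rw [Finset.mem_filter] at hs
    ext a; fin_cases a <;> simp [hs.2]
  · intro s hs
    rw [Finset.mem_filter] at hs
    have h1 : (Finset.univ.erase (0 : Fin 2)) = {1} := by decide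
    have h2 : ![j, s 1] = s := by ext a; fin_cases a <;> simp [hs.2]
    rw [h1, Finset.prod_singleton, h2]

theorem expectedPayoff_two_one {n : ℕ} (G : NormalFormGame 2 n) (q : Fin 2 → Fin n → ℝ)
    (j : Fin n) :
    G.expectedPayoff q 1 j = ∑ j', (G.payoff 1 ![j', j] : ℝ) * q 0 j' := by
  rw [expectedPayoff]
  refine Finset.sum_bij' (fun s _ => s 0) (fun j' _ => ![j', j]) (by simp) (by simp) ?_ (by simp) ?_
  · intro s hs
    rw [Finset.mem_filter] at hs
    ext a; fin_cases a <;> simp [hs.2]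
  · intro s hs
    rw [Finset.mem_filter] at hs
    have h1 : (Finset.univ.erase (1 : Fin 2)) = {0} := by decide
    have h2 : ![s 0, j] = s := by ext a; fin_cases a <;> simp [hs.2]
    rw [h1, Finset.prod_singleton, h2]

end NormalFormGame

namespace Layout

variable (L : Layout)

/-- Denominator of the payoff of the original game that enters a payoff of the new one. -/
def factor (B : ℕ → ℕ) (v u : ℕ) : ℕ := if L.hit v u = 1 then B (L.pair u) else 1

/-- Numerators of the payoffs of the second player. -/
def entryNum (A B : ℕ → ℕ) (D v u : ℕ) : ℕ :=
  (L.coef v u * D + L.const v) * L.factor B v u + L.hit v u * A (L.pair u)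

/-- Denominators of the payoffs of the second player. -/
def entryDen (B : ℕ → ℕ) (D v u : ℕ) : ℕ := 16 * D * L.factor B v u

variable {L}

theorem hit_le_one (v u : ℕ) : L.hit v u ≤ 1 := by
  unfold hit
  split_ifs
  · omega
  · omega
  · exact Nat.mul_le_mul (kron_le_one _ _) (Nat.mul_le_mul (kron_le_one _ _) (kron_le_one _ _))
  · omega

theorem coef_le (v u : ℕ) : L.coef v u ≤ 14 := by
  have h := fun c => kron_le_one u c
  unfold coef
  split_ifs
  · omega
  · omega
  · omega
  · omega
  · omega
  · have h1 := h (L.start (L.block v) + 5)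
    have h2 := h (L.right (L.block v))
    have h3 := h (L.left (L.block v))
    have h4 := h (v - 2)
    have h5 := h (v + 6)
    unfold blockCoef
    split_ifs <;> omega

theorem const_le (v : ℕ) : L.const v ≤ 3 := by
  unfold const blockConst
  split_ifs <;> omega

theorem pair_lt_of_lt_size {u : ℕ} (hk : 0 < L.k) (hu : u < L.size) (hu' : L.base ≤ u) :
    L.pair u < L.k * L.profiles := by
  rw [pair, Nat.div_lt_iff_lt_mul (Nat.mul_pos hk width_pos), ← mul_assoc]
  unfold size at hu
  omega

theorem base_le_of_hit {v u : ℕ} (h : L.hit v u = 1) : L.base ≤ u := by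
  by_contra hu
  unfold hit at h
  split_ifs at h; omega

section game

variable {A B : ℕ → ℕ} {D : ℕ}

theorem factor_pos (hk : 0 < L.k) (hB : ∀ h < L.k * L.profiles, 0 < B h) {v u : ℕ}
    (hu : u < L.size) : 0 < L.factor B v u := by
  unfold factor
  split_ifs with h
  · exact hB _ (pair_lt_of_lt_size hk hu (base_le_of_hit h))
  · exact one_pos

theorem hit_mul_le (hk : 0 < L.k) (hA : ∀ h < L.k * L.profiles, A h ≤ B h) {v u : ℕ}
    (hu : u < L.size) : L.hit v u * A (L.pair u) ≤ L.factor B v u := by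
  unfold factor
  split_ifs with h
  · rw [h, one_mul]
    exact hA _ (pair_lt_of_lt_size hk hu (base_le_of_hit h))
  · have := L.hit_le_one v u
    rw [show L.hit v u = 0 by omega, zero_mul]
    exact zero_le_one

/-- Coefficients are at most `14` and constants at most `3`; one more unit for the original payoff
still fits below `16 * D` because `D ≥ 2`. -/
theorem entryNum_le (hk : 0 < L.k) (hA : ∀ h < L.k * L.profiles, A h ≤ B h) (hD : 2 ≤ D)
    {v u : ℕ} (hu : u < L.size) : L.entryNum A B D v u ≤ L.entryDen B D v u := by
  have h1 := hit_mul_le hk hA (v := v) hu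
  have h2 := L.coef_le v u
  have h3 := L.const_le v
  unfold entryNum entryDen
  have h4 : L.coef v u * D + L.const v + 1 ≤ 16 * D := by nlinarith
  calc _ ≤ (L.coef v u * D + L.const v) * L.factor B v u + L.factor B v u := by omega
    _ = (L.coef v u * D + L.const v + 1) * L.factor B v u := by ring
    _ ≤ _ := Nat.mul_le_mul_right _ h4

theorem entry_eq (hk : 0 < L.k) (hB : ∀ h < L.k * L.profiles, 0 < B h) (hD : 0 < D) {v u : ℕ}
    (hu : u < L.size) :
    (L.entryNum A B D v u : ℝ) / L.entryDen B D v u =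
      (L.coef v u + L.const v / D + L.hit v u * ((A (L.pair u) : ℝ) / B (L.pair u)) / D) / 16 := by
  have hD' : (D : ℝ) ≠ 0 := by exact_mod_cast hD.ne'
  have hf : (L.factor B v u : ℝ) ≠ 0 := by exact_mod_cast (factor_pos hk hB hu).ne'
  have h1 : (L.hit v u * ((A (L.pair u) : ℝ) / B (L.pair u))) =
      L.hit v u * A (L.pair u) / L.factor B v u := by
    unfold factor
    split_ifs with h
    · rw [mul_div_assoc]
    · have := L.hit_le_one v u
      rw [show L.hit v u = 0 by omega]
      simp
  rw [h1]
  unfold entryNum entryDen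
  push_cast
  field_simp

/-- The first player imitates the second; the second plays the layout. -/
def game (L : Layout) (A B : ℕ → ℕ) (D : ℕ) (hk : 0 < L.k)
    (hA : ∀ h < L.k * L.profiles, A h ≤ B h) (hD : 2 ≤ D) : NormalFormGame 2 L.size where
  payoff i s := if i = 0 then (if s 0 = s 1 then 1 else 0)
    else (L.entryNum A B D (s 1) (s 0) : ℚ) / L.entryDen B D (s 1) (s 0)
  payoff_nonneg i s := by
    split_ifs
    · exact zero_le_one
    · exact le_rfl
    · positivity
  payoff_le_one i s := by
    split_ifs
    · exact le_rfl
    · exact zero_le_one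
    · exact div_le_one_of_le₀ (by exact_mod_cast entryNum_le hk hA hD (s 0).2) (by positivity)

/-- The strategies of the original players among those of the first player. -/
def mapping (L : Layout) : GameMapping L.k L.n 2 L.size where
  player _ := 0
  strategy i j := ⟨2 + i * L.n + j, player_lt_size i.2 j.2⟩
  strategy_injective i j j' h := by
    simp only [Fin.mk.injEq] at h
    exact Fin.ext (by omega)

/-- The weights of a mixed strategy, scaled and indexed by natural numbers. -/
noncomputable def weights (L : Layout) (D : ℝ) (q : Fin L.size → ℝ) (u : ℕ) : ℝ :=
  if h : u < L.size then D * q ⟨u, h⟩ else 0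

theorem sum_range_weights {D : ℝ} (q : Fin L.size → ℝ) (f : ℕ → ℝ) :
    ∑ u ∈ Finset.range L.size, f u * L.weights D q u = D * ∑ u : Fin L.size, f u * q u := by
  rw [← Fin.sum_univ_eq_sum_range (fun u => f u * L.weights D q u), Finset.mul_sum]
  refine Finset.sum_congr rfl fun u _ => ?_
  rw [weights, dif_pos u.2]
  ring

variable (hk : 0 < L.k) (hA : ∀ h < L.k * L.profiles, A h ≤ B h) (hD : 2 ≤ D)

theorem expectedPayoff_game_zero (q : Fin 2 → Fin L.size → ℝ) (u : Fin L.size) :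
    (L.game A B D hk hA hD).expectedPayoff q 0 u = q 1 u := by
  rw [NormalFormGame.expectedPayoff_two_zero, Finset.sum_eq_single u]
  · simp [game]
  · intro v _ hv
    simp [game, hv.symm]
  · simp

/-- The weights of `q 0` sum to `1`, so constants can be spread over the matrix entries and the
shift by `8` becomes the summand `8 / 16`. Up to an increasing affine map, the expected payoffs are
the rows. -/
theorem expectedPayoff_game_one (hB : ∀ h < L.k * L.profiles, 0 < B h)
    {q : Fin 2 → Fin L.size → ℝ} (hq : ∑ u, q 0 u = 1) (v : Fin L.size) :
    (L.game A B D hk hA hD).expectedPayoff q 1 v =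
      1 / 2 + L.row (fun h => (A h : ℝ) / B h) (L.weights D (q 0)) D v / (16 * D) := by
  have hD' : (D : ℝ) ≠ 0 := by
    have : D ≠ 0 := by omega
    exact_mod_cast this
  have h1 : ∀ u : Fin L.size, (((L.game A B D hk hA hD).payoff 1 ![u, v] : ℚ) : ℝ) * q 0 u =
      (((L.coef v u : ℝ) - 8) * q 0 u) / 16 + (1 / 2 + L.const v / (16 * D)) * q 0 u +
        ((L.hit v u * ((A (L.pair u) : ℝ) / B (L.pair u))) * q 0 u) / (16 * D) := by
    intro u
    have h2 : (((L.game A B D hk hA hD).payoff 1 ![u, v] : ℚ) : ℝ) =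
        (L.entryNum A B D v u : ℝ) / L.entryDen B D v u := by
      simp [game]
    rw [h2, entry_eq hk hB (by omega) u.2]
    field_simp
    ring
  rw [NormalFormGame.expectedPayoff_two_one, Finset.sum_congr rfl (fun u _ => h1 u),
    Finset.sum_add_distrib, Finset.sum_add_distrib, ← Finset.sum_div, ← Finset.mul_sum, hq,
    ← Finset.sum_div, row, sum_range_weights (q 0) (fun u => (L.coef v u : ℝ) - 8),
    sum_range_weights (q 0) (fun u => L.hit v u * ((A (L.pair u) : ℝ) / B (L.pair u)))]
  field_simp
  ring

/-- Imitation transfers used strategies from player 0 to player 1, whose equilibrium condition is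
then one about the rows. Undoing the scaling by `16 * D` turns `ε` into `16 * D * ε`. -/
theorem isEquilibrium_weights (hB : ∀ h < L.k * L.profiles, 0 < B h) {q : Fin 2 → Fin L.size → ℝ}
    {ε : ℝ} (hq : (L.game A B D hk hA hD).IsWellSupportedNash ε q) (hn : 0 < L.n) (hR : 0 < L.R)
    (hε : 0 ≤ ε) (hεD : 100 * (16 * D * ε) ≤ 1) (hprof : 100 * L.profiles ≤ D)
    (hsize : 8 * L.size < D) :
    L.IsEquilibrium (fun h => (A h : ℝ) / B h) (L.weights D (q 0)) D (16 * D * ε) := by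
  have hD0 : (0 : ℝ) < D := by
    have : 0 < D := by omega
    exact_mod_cast this
  have hsum0 := (hq.1 0).2
  refine ⟨?_, ?_, ?_, ?_, ?_, ?_, hk, hn, hR, by positivity, hεD, by exact_mod_cast hprof,
    by exact_mod_cast hsize⟩
  · intro u
    unfold weights
    split_ifs
    · exact mul_nonneg hD0.le ((hq.1 0).1 _)
    · exact le_rfl
  · intro u hu
    rw [weights, dif_neg (by omega)]
  · have := sum_range_weights (D := D) (q 0) (fun _ => 1)
    simpa [hsum0] using this
  · intro u hu hpos v hv
    have hu0 : 0 < q 0 ⟨u, hu⟩ := by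
      rw [weights, dif_pos hu] at hpos
      exact (pos_iff_pos_of_mul_pos hpos).1 hD0
    -- If player 0 used a strategy that player 1 does not, imitation would earn at most `ε`
    -- everywhere, so player 1's total probability would be at most `L.size * ε < 1`.
    have hu1 : 0 < q 1 ⟨u, hu⟩ := by
      refine lt_of_le_of_ne ((hq.1 1).1 _) fun h0 => ?_
      have h1 : ∀ v ∈ Finset.univ, q 1 v ≤ ε := by
        intro v _
        have := hq.2 0 _ hu0 v
        rw [expectedPayoff_game_zero, expectedPayoff_game_zero, ← h0] at this
        linarith
      have h2 := Finset.sum_le_sum h1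
      rw [(hq.1 1).2, Finset.sum_const, Finset.card_univ, Fintype.card_fin, nsmul_eq_mul] at h2
      have h3 : (8 : ℝ) * L.size < D := by exact_mod_cast hsize
      nlinarith
    have h1 := hq.2 1 _ hu1 ⟨v, hv⟩
    rw [expectedPayoff_game_one hk hA hD hB hsum0, expectedPayoff_game_one hk hA hD hB hsum0] at h1
    dsimp only at h1
    set r := L.row (fun h => (A h : ℝ) / B h) (L.weights D (q 0)) D
    have h2 : r v / (16 * D) ≤ r u / (16 * D) + ε := by linarith
    rw [div_add' _ _ _ (by positivity), div_le_div_iff_of_pos_right (by positivity)] at h2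
    linarith
  · intro h _
    positivity
  · intro h hh
    exact div_le_one_of_le₀ (by exact_mod_cast hA h hh) (by positivity)

/-- `A / B` are the payoffs of `G`, in the order of the encoding. -/
def Lists (L : Layout) (A B : ℕ → ℕ) (G : NormalFormGame L.k L.n) : Prop :=
  ∀ (i : Fin L.k) (t : Fin (L.n ^ L.k)), (G.payoff i (finFunctionFinEquiv.symm t) : ℝ) =
    (A (i * L.profiles + t) : ℝ) / B (i * L.profiles + t)

omit hk hA hD in
-- The scaling by `D` cancels in the quotient.
theorem renormalize_mapping {D : ℝ} (hD : D ≠ 0) (q : Fin 2 → Fin L.size → ℝ) (i : Fin L.k)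
    (j : Fin L.n) :
    L.mapping.renormalize q i j = L.profile (L.weights D (q 0)) i j := by
  have h : ∀ j : Fin L.n, L.weights D (q 0) (2 + i * L.n + j) =
      D * q (L.mapping.player i) (L.mapping.strategy i j) := fun j => by
    rw [weights, dif_pos (player_lt_size i.2 j.2)]
    rfl
  rw [GameMapping.renormalize, profile,
    ← Fin.sum_univ_eq_sum_range (fun j' => L.weights D (q 0) (2 + i * L.n + j')), h]
  simp only [h]
  rw [← Finset.mul_sum, mul_div_mul_left _ _ hD]

omit hk hA hD in
theorem expectedPayoff_eq_payoff {G : NormalFormGame L.k L.n} (hG : L.Lists A B G) {x : ℕ → ℝ}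
    {p : Fin L.k → Fin L.n → ℝ} (hp : ∀ i j, p i j = L.profile x i j) (i : Fin L.k) (j : Fin L.n) :
    G.expectedPayoff p i j = L.payoff (fun h => (A h : ℝ) / B h) x i j := by
  have hdig : ∀ (t : Fin (L.n ^ L.k)) (l : Fin L.k),
      ((finFunctionFinEquiv.symm t l : Fin L.n) : ℕ) = L.digit t l := fun t l => by
    rw [finFunctionFinEquiv_symm_apply_val, digit, pow, if_pos l.2.le]
  rw [NormalFormGame.expectedPayoff, payoff, profiles,
    ← Fin.sum_univ_eq_sum_range (fun s => (kron (L.digit s i) j : ℝ) *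
      ((A (i * L.n ^ L.k + s) : ℝ) / B (i * L.n ^ L.k + s)) *
      ∏ l ∈ Finset.range L.k, (if l = i then 1 else L.profile x l (L.digit s l))),
    Finset.sum_filter, ← Equiv.sum_comp finFunctionFinEquiv.symm]
  refine Finset.sum_congr rfl fun t _ => ?_
  rw [hG i t, kron, ← hdig t i]
  have hprod : ∏ i' ∈ Finset.univ.erase i, p i' (finFunctionFinEquiv.symm t i') =
      ∏ l ∈ Finset.range L.k, (if l = (i : ℕ) then 1 else L.profile x l (L.digit t l)) := by
    rw [← Fin.prod_univ_eq_prod_range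
        (fun l => if l = (i : ℕ) then 1 else L.profile x l (L.digit t l)),
      ← Finset.mul_prod_erase Finset.univ _ (Finset.mem_univ i), if_pos rfl, one_mul]
    refine Finset.prod_congr rfl fun l hl => ?_
    rw [if_neg (fun h => Finset.ne_of_mem_erase hl (Fin.ext h)), hp, hdig]
  by_cases h : finFunctionFinEquiv.symm t i = j
  · rw [if_pos h, if_pos (congrArg Fin.val h), hprod, profiles]; push_cast; ring
  · rw [if_neg h, if_neg (fun h' => h (Fin.ext h'))]; push_cast; ring

/-- Parameters for which the layout is a direct reduction with error `1 / E`. -/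
theorem isDirectReduction {E : ℕ} {e ε : ℝ} (hn : 0 < L.n) (hR : 0 < L.R) (hE : 0 < E)
    (hlevels : 256 * (L.profiles * L.k) * E ≤ 4 ^ (L.R - 1)) (hDE : D = 2048 * E * L.size ^ 2)
    (hB : ∀ h < L.k * L.profiles, 0 < B h) {G : NormalFormGame L.k L.n} (hG : L.Lists A B G)
    (he : 1 / (E : ℝ) ≤ e) (hε0 : 0 ≤ ε) (hε : ε ≤ 1 / (2 ^ 30 * E ^ 3 * L.size ^ 4)) :
    IsDirectReduction G e (L.game A B D hk hA hD) ε L.mapping := by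
  intro q hq
  have hNk : L.profiles * L.k ≤ L.size := by
    have h1 : 1 ≤ L.k * L.width := Nat.mul_pos hk width_pos
    have h2 := Nat.mul_le_mul_left (L.k * L.profiles) h1
    have h3 : L.size = L.base + L.k * L.profiles * (L.k * L.width) := by unfold size; ring
    nlinarith
  have hN : L.profiles ≤ L.size := le_trans (Nat.le_mul_of_pos_right _ hk) hNk
  have hs : 0 < L.size := L.size_pos
  have hs' : (1 : ℝ) ≤ L.size := by exact_mod_cast hs
  have hE' : (1 : ℝ) ≤ E := by exact_mod_cast hE
  have hN' : (L.profiles : ℝ) ≤ L.size := by exact_mod_cast hN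
  have hNk' : (L.profiles : ℝ) * L.k ≤ L.size := by exact_mod_cast hNk
  have hDE' : (D : ℝ) = 2048 * E * L.size ^ 2 := by exact_mod_cast hDE
  have hD0 : (0 : ℝ) < D := by rw [hDE']; positivity
  -- `16 * 2048 ^ 2 = 2 ^ 26`, so the factor `2 ^ 30` leaves `1 / 16`.
  have hDη : D * (16 * D * ε) ≤ 1 / (16 * E) := by
    calc D * (16 * D * ε) = 16 * D ^ 2 * ε := by ring
      _ ≤ 16 * D ^ 2 * (1 / (2 ^ 30 * E ^ 3 * L.size ^ 4)) := by gcongr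
      _ = 1 / (16 * E) := by rw [hDE']; field_simp; norm_num
  have hlarge : 2048 * L.size ≤ D := by
    rw [hDE]
    have : 1 ≤ E * L.size := Nat.mul_pos hE hs
    nlinarith
  have hlarge' : 2048 * (L.size : ℝ) ≤ D := by exact_mod_cast hlarge
  have hη0 : 0 ≤ 16 * D * ε := by positivity
  have hη : 2048 * L.size * (16 * D * ε) ≤ 1 / (16 * E) :=
    (mul_le_mul_of_nonneg_right hlarge' hη0).trans hDη
  have hE16 : 1 / (16 * (E : ℝ)) ≤ 1 / 16 := by
    apply one_div_le_one_div_of_le <;> linarith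
  have hEq := isEquilibrium_weights hk hA hD hB hq hn hR hε0 (by nlinarith) (by omega) (by omega)
  set η : ℝ := 16 * D * ε with hηdef
  set x := L.weights D (q 0) with hx
  have hp : ∀ i j, L.mapping.renormalize q i j = L.profile x i j :=
    renormalize_mapping hD0.ne' q
  -- The error budget: `1/16` for `D * η`, `1/4` for the payoff terms in the rows, `1/16` for gate
  -- errors and `1/4` for the truncated squaring circuits, in units of `1 / E`.
  have hfin : D * η + 2 * (L.profiles * (L.k * (65 * (3 * L.profiles / D + η) +
      32 / 4 ^ (L.R - 1)))) ≤ 1 / (E : ℝ) := by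
    have h1 : (L.profiles : ℝ) * L.k * (390 * L.profiles / D) ≤ 1 / (4 * E) := by
      rw [mul_div_assoc', div_le_div_iff₀ hD0 (by positivity), hDE']
      have : (L.profiles : ℝ) * L.k * L.profiles ≤ L.size * L.size :=
        mul_le_mul hNk' hN' (by positivity) (by positivity)
      nlinarith
    have h2 : (L.profiles : ℝ) * L.k * (130 * η) ≤ 1 / (16 * E) := by
      refine le_trans ?_ hη
      nlinarith
    have h3 : (L.profiles : ℝ) * L.k * (64 / 4 ^ (L.R - 1)) ≤ 1 / (4 * E) := by
      have h4 : (256 : ℝ) * (L.profiles * L.k) * E ≤ 4 ^ (L.R - 1) := by exact_mod_cast hlevels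
      rw [mul_div_assoc', div_le_div_iff₀ (by positivity) (by positivity)]
      linarith
    have h5 : D * η + 2 * (L.profiles * (L.k * (65 * (3 * L.profiles / D + η) +
        32 / 4 ^ (L.R - 1)))) = D * η + (L.profiles : ℝ) * L.k * (390 * L.profiles / D) +
        (L.profiles : ℝ) * L.k * (130 * η) + (L.profiles : ℝ) * L.k * (64 / 4 ^ (L.R - 1)) := by
      ring
    have h6 : 1 / (16 * (E : ℝ)) + 1 / (4 * E) + 1 / (16 * E) + 1 / (4 * E) ≤ 1 / E := by
      rw [div_add_div _ _ (by positivity) (by positivity),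
        div_add_div _ _ (by positivity) (by positivity),
        div_add_div _ _ (by positivity) (by positivity),
        div_le_div_iff₀ (by positivity) (by positivity)]
      have : (0 : ℝ) < E ^ 4 := by positivity
      nlinarith
    linarith
  refine ⟨fun i => ⟨fun j => ?_, ?_⟩, fun i j hij j' => ?_⟩
  · rw [hp]; exact hEq.profile_nonneg _ _
  · simp only [hp]
    rw [Fin.sum_univ_eq_sum_range (fun j => L.profile x i j)]
    simp only [profile]
    rw [← Finset.sum_div, div_self (hEq.weight_pos i.2).ne']
  · rw [expectedPayoff_eq_payoff hG hp, expectedPayoff_eq_payoff hG hp]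
    have hpos : 0 < x (2 + i * L.n + j) := by
      refine lt_of_le_of_ne (hEq.nonneg _) fun h0 => hij.ne ?_
      rw [hp, profile, ← h0, zero_div]
    have := hEq.payoff_le i.2 j.2 j'.2 hpos
    linarith

end game

end Layout

/-! ### The program -/

namespace Layout

/-- Payoff numerators of the new game in the order of the encoding. -/
def codeNum (L : Layout) (A B : ℕ → ℕ) (D h : ℕ) : ℕ :=
  if h < L.size * L.size then kron (h % L.size) (h / L.size)
  else L.entryNum A B D ((h - L.size * L.size) / L.size) ((h - L.size * L.size) % L.size)

/-- Payoff denominators of the new game in the order of the encoding. -/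
def codeDen (L : Layout) (B : ℕ → ℕ) (D h : ℕ) : ℕ :=
  if h < L.size * L.size then 1
  else L.entryDen B D ((h - L.size * L.size) / L.size) ((h - L.size * L.size) % L.size)

/-- Entry number `t` of the output. -/
def outputEntry (L : Layout) (A B : ℕ → ℕ) (D t : ℕ) : ℕ :=
  if t = 0 then 2 else if t = 1 then L.size
  else if t - 2 < 2 * (L.size * L.size) * 2 then
    if (t - 2) % 2 = 0 then L.codeNum A B D ((t - 2) / 2) else L.codeDen B D ((t - 2) / 2)
  else if t - 2 - 2 * (L.size * L.size) * 2 < L.k then 0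
  else 2 + (t - 2 - 2 * (L.size * L.size) * 2 - L.k)

/-- Length of the output. -/
def outputLength (L : Layout) : ℕ := 2 + (2 * (L.size * L.size) * 2 + (L.k + L.k * L.n))

end Layout

namespace RAM

namespace Expr

/-! The expressions below compute the parameters and the functions of a layout. The expression `eb`
stands for the precision and `eE` for the inverse of the error. -/

variable (eb eE : Expr)

/-- Number of players. -/
def players : Expr := get 0 1

/-- Number of strategies per player. -/
def strategies : Expr := get 0 2

/-- Number of profiles. -/
def profiles : Expr := get 3 players

/-- Number of levels. -/
def levels : Expr := eb + players * profiles + 5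

/-- Number of the first strategy of the first block. -/
def base : Expr := 2 + players * strategies

/-- Size of a block. -/
def width : Expr := 6 * levels eb + 2

/-- Number of strategies of the new game. -/
def size : Expr := base + players * profiles * players * width eb

/-- Scaling factor. -/
def scale : Expr := 2048 * eE * (size eb * size eb)

/-- Strategy of a player in a profile. -/
def digit (s i : Expr) : Expr := mod (s / get 3 i) strategies

/-- First factor of a block. -/
def left (b : Expr) : Expr := ifEq (mod b players) 0 1 (base + b * width eb - 1)

/-- Second factor of a block. -/
def right (b : Expr) : Expr :=
  ifEq (mod b players) (b / players / profiles) 1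
    (2 + mod b players * strategies + digit (mod (b / players) profiles) (mod b players))

/-- Block of a strategy. -/
def block (v : Expr) : Expr := (v - base) / width eb

/-- Position of a strategy in its block. -/
def offset (v : Expr) : Expr := mod (v - base) (width eb)

/-- First strategy of a block. -/
def start (b : Expr) : Expr := base + b * width eb

/-- Coefficients of the rows of the blocks. -/
def blockCoef (v u : Expr) : Expr :=
  ifEq (offset eb v) (6 * levels eb + 1) (8 - (eqInd u (v - 1) + eqInd u v)) <|
  ifEq (offset eb v) (6 * levels eb)
    (8 + (4 * eqInd u (start eb (block eb v) + 5) + 2 * eqInd u (right (block eb v))) -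
      (4 * eqInd u (start eb (block eb v) + 2) + 2 * eqInd u (left eb (block eb v)) +
        4 * eqInd u v)) <|
  ifEq (mod (offset eb v) 3) 1 (8 - (2 * eqInd u (v - 1) + eqInd u v)) <|
  ifEq (mod (offset eb v) 3) 2
    (8 + (4 * eqInd u (v - 2) + eqInd u (v + 6)) - (2 * eqInd u (v + 4) + 4 * eqInd u v)) <|
  ifEq (offset eb v) 0
    (8 + (eqInd u (left eb (block eb v)) + eqInd u (right (block eb v))) - 2 * eqInd u v) <|
  ifEq (offset eb v) 3
    (8 + eqInd u (left eb (block eb v)) - (eqInd u (right (block eb v)) + 2 * eqInd u v))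
    (8 - (2 * eqInd u (v - 5) + 2 * eqInd u (v - 6) + eqInd u v))

/-- Constant terms of the rows of the blocks. -/
def blockConst (v : Expr) : Expr :=
  ifEq (offset eb v) (6 * levels eb + 1) 1 <|
  ifEq (offset eb v) (6 * levels eb) 3 <|
  ifEq (mod (offset eb v) 3) 1 1 <|
  ifEq (mod (offset eb v) 3) 2 0 <|
  ifEq (offset eb v) 0 0 <|
  ifEq (offset eb v) 3 1 2

/-- Original player of a strategy. -/
def player (v : Expr) : Expr := (v - 2) / strategies

/-- Coefficients of all rows. -/
def coef (v u : Expr) : Expr :=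
  ifEq v 0 8 <| ifEq v 1 (8 - eqInd u 1) <|
  ifLt v base (ifLt u 2 8 (ifLt u base (8 - eqInd (player u) (player v)) 8)) (blockCoef eb v u)

/-- Constant terms of all rows. -/
def const (v : Expr) : Expr := ifEq v 0 0 (ifLt v base 1 (blockConst eb v))

/-- Pair of a player and a profile. -/
def pair (u : Expr) : Expr := (u - base) / (players * width eb)

/-- Whether a payoff of the original game enters. -/
def hit (v u : Expr) : Expr :=
  ifLt v 2 0 <| ifLt v base
    (ifLt u base 0 (eqInd (mod (u - base) (players * width eb)) (players * width eb - 1) *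
      (eqInd (pair eb u / profiles) (player v) *
        eqInd (digit (mod (pair eb u) profiles) (player v)) (mod (v - 2) strategies)))) 0

/-- Denominator of the payoff of the original game that enters. -/
def factor (v u : Expr) : Expr := ifEq (hit eb v u) 1 (get 0 (4 + 2 * pair eb u)) 1

/-- Numerators of the payoffs of the second player. -/
def entryNum (v u : Expr) : Expr :=
  (coef eb v u * scale eb eE + const eb v) * factor eb v u +
    hit eb v u * get 0 (3 + 2 * pair eb u)

/-- Denominators of the payoffs of the second player. -/
def entryDen (v u : Expr) : Expr := 16 * scale eb eE * factor eb v u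

/-- Payoff numerators in the order of the encoding. -/
def codeNum (h : Expr) : Expr :=
  ifLt h (size eb * size eb) (eqInd (mod h (size eb)) (h / size eb))
    (entryNum eb eE ((h - size eb * size eb) / size eb) (mod (h - size eb * size eb) (size eb)))

/-- Payoff denominators in the order of the encoding. -/
def codeDen (h : Expr) : Expr :=
  ifLt h (size eb * size eb) 1
    (entryDen eb eE ((h - size eb * size eb) / size eb) (mod (h - size eb * size eb) (size eb)))

/-- Entries of the output. -/
def outputEntry (t : Expr) : Expr :=
  ifEq t 0 2 <| ifEq t 1 (size eb) <|
  ifLt (t - 2) (2 * (size eb * size eb) * 2)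
    (ifEq (mod (t - 2) 2) 0 (codeNum eb eE ((t - 2) / 2)) (codeDen eb eE ((t - 2) / 2))) <|
  ifLt (t - 2 - 2 * (size eb * size eb) * 2) players 0
    (2 + (t - 2 - 2 * (size eb * size eb) * 2 - players))

/-- Length of the output. -/
def outputLength : Expr :=
  2 + (2 * (size eb * size eb) * 2 + (players + players * strategies))

/-! ### Absence of reads from the output array -/

section avoids

variable {eb eE} (hb : eb.AvoidsOutput) {s t u v i : Expr}
include hb

omit hb in
@[simp] theorem avoids_players : players.AvoidsOutput := by simp [players]

omit hb in
@[simp] theorem avoids_strategies : strategies.AvoidsOutput := by simp [strategies]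

omit hb in
@[simp] theorem avoids_profiles : profiles.AvoidsOutput := by simp [profiles]

omit hb in
@[simp] theorem avoids_base : base.AvoidsOutput := by simp [base]

theorem avoids_levels : (levels eb).AvoidsOutput := by simp [levels, hb]

theorem avoids_width : (width eb).AvoidsOutput := by simp [width, avoids_levels hb]

theorem avoids_size : (size eb).AvoidsOutput := by simp [size, avoids_width hb]

omit hb in
theorem avoids_digit (hs : s.AvoidsOutput) (hi : i.AvoidsOutput) : (digit s i).AvoidsOutput := by
  simp [digit, hs, hi]

theorem avoids_left (hs : s.AvoidsOutput) : (left eb s).AvoidsOutput := by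
  simp [left, hs, avoids_width hb]

omit hb in
theorem avoids_right (hs : s.AvoidsOutput) : (right s).AvoidsOutput := by
  simp [right, hs, avoids_digit]

theorem avoids_block (hs : s.AvoidsOutput) : (block eb s).AvoidsOutput := by
  simp [block, hs, avoids_width hb]

theorem avoids_offset (hs : s.AvoidsOutput) : (offset eb s).AvoidsOutput := by
  simp [offset, hs, avoids_width hb]

theorem avoids_start (hs : s.AvoidsOutput) : (start eb s).AvoidsOutput := by
  simp [start, hs, avoids_width hb]

theorem avoids_blockCoef (hv : v.AvoidsOutput) (hu : u.AvoidsOutput) :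
    (blockCoef eb v u).AvoidsOutput := by
  simp [blockCoef, hv, hu, avoids_offset hb hv, avoids_levels hb,
    avoids_right (avoids_block hb hv), avoids_left hb (avoids_block hb hv),
    avoids_start hb (avoids_block hb hv)]

theorem avoids_blockConst (hv : v.AvoidsOutput) : (blockConst eb v).AvoidsOutput := by
  simp [blockConst, avoids_offset hb hv, avoids_levels hb]

omit hb in
theorem avoids_player (hv : v.AvoidsOutput) : (player v).AvoidsOutput := by simp [player, hv]

theorem avoids_coef (hv : v.AvoidsOutput) (hu : u.AvoidsOutput) : (coef eb v u).AvoidsOutput := by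
  simp [coef, hv, hu, avoids_player, avoids_blockCoef hb]

theorem avoids_const (hv : v.AvoidsOutput) : (const eb v).AvoidsOutput := by
  simp [const, hv, avoids_blockConst hb]

theorem avoids_pair (hu : u.AvoidsOutput) : (pair eb u).AvoidsOutput := by
  simp [pair, hu, avoids_width hb]

theorem avoids_hit (hv : v.AvoidsOutput) (hu : u.AvoidsOutput) : (hit eb v u).AvoidsOutput := by
  simp [hit, hv, hu, avoids_pair hb, avoids_width hb, avoids_player, avoids_digit]

theorem avoids_factor (hv : v.AvoidsOutput) (hu : u.AvoidsOutput) :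
    (factor eb v u).AvoidsOutput := by
  simp [factor, avoids_hit hb hv hu, avoids_pair hb hu]

variable (hE : eE.AvoidsOutput)
include hE

theorem avoids_scale : (scale eb eE).AvoidsOutput := by simp [scale, hE, avoids_size hb]

theorem avoids_entryNum (hv : v.AvoidsOutput) (hu : u.AvoidsOutput) :
    (entryNum eb eE v u).AvoidsOutput := by
  simp [entryNum, avoids_hit hb hv hu, avoids_pair hb hu, avoids_factor hb hv hu,
    avoids_coef hb hv hu, avoids_const hb hv, avoids_scale hb hE]

theorem avoids_entryDen (hv : v.AvoidsOutput) (hu : u.AvoidsOutput) :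
    (entryDen eb eE v u).AvoidsOutput := by
  simp [entryDen, avoids_factor hb hv hu, avoids_scale hb hE]

theorem avoids_codeNum (ht : t.AvoidsOutput) : (codeNum eb eE t).AvoidsOutput := by
  simp [codeNum, ht, avoids_size hb, avoids_entryNum hb hE]

theorem avoids_codeDen (ht : t.AvoidsOutput) : (codeDen eb eE t).AvoidsOutput := by
  simp [codeDen, ht, avoids_size hb, avoids_entryDen hb hE]

theorem avoids_outputEntry (ht : t.AvoidsOutput) : (outputEntry eb eE t).AvoidsOutput := by
  simp [outputEntry, ht, avoids_size hb, avoids_codeNum hb hE, avoids_codeDen hb hE]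

omit hE in
theorem avoids_outputLength : (outputLength eb).AvoidsOutput := by
  simp [outputLength, avoids_size hb]

end avoids

/-- The memory holds the parameters of the layout `L`. -/
structure Holds (eb eE : Expr) (m : Mem) (L : Layout) (E : ℕ) : Prop where
  k_eq : m 0 1 = L.k
  n_eq : m 0 2 = L.n
  pow_eq : m 3 = L.pow
  R_eq : eb.eval m + L.k * L.profiles + 5 = L.R
  E_eq : eE.eval m = E

/-! ### Agreement of the expressions with the layout -/

section eval

variable {eb eE} {m : Mem} {L : Layout} {E : ℕ} (h : Holds eb eE m L E) (s t u v i : Expr)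
include h

theorem eval_players : players.eval m = L.k := by simp [players, h.k_eq]

theorem eval_strategies : strategies.eval m = L.n := by simp [strategies, h.n_eq]

theorem eval_profiles : profiles.eval m = L.profiles := by
  simp [profiles, eval_players h, h.pow_eq, Layout.pow, Layout.profiles]

theorem eval_levels : (levels eb).eval m = L.R := by
  simp [levels, eval_players h, eval_profiles h, h.R_eq]

theorem eval_base : base.eval m = L.base := by
  simp [base, eval_players h, eval_strategies h, Layout.base]

theorem eval_width : (width eb).eval m = L.width := by
  simp [width, eval_levels h, Layout.width]

theorem eval_size : (size eb).eval m = L.size := by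
  simp [size, eval_base h, eval_players h, eval_profiles h, eval_width h, Layout.size]

theorem eval_scale : (scale eb eE).eval m = 2048 * E * L.size ^ 2 := by
  simp [scale, eval_size h, h.E_eq, sq]

theorem eval_digit : (digit s i).eval m = L.digit (s.eval m) (i.eval m) := by
  simp [digit, eval_strategies h, h.pow_eq, Layout.digit]

theorem eval_left : (left eb s).eval m = L.left (s.eval m) := by
  simp [left, eval_players h, eval_base h, eval_width h, Layout.left]

theorem eval_right : (right s).eval m = L.right (s.eval m) := by
  simp [right, eval_players h, eval_profiles h, eval_strategies h, eval_digit h, Layout.right]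

theorem eval_block : (block eb v).eval m = L.block (v.eval m) := by
  simp [block, eval_base h, eval_width h, Layout.block]

theorem eval_offset : (offset eb v).eval m = L.offset (v.eval m) := by
  simp [offset, eval_base h, eval_width h, Layout.offset]

theorem eval_start : (start eb s).eval m = L.start (s.eval m) := by
  simp [start, eval_base h, eval_width h, Layout.start]

omit h in
theorem eval_eqInd_eq_kron : (eqInd u v).eval m = kron (u.eval m) (v.eval m) := by
  rw [eval_eqInd, kron]

theorem eval_blockCoef : (blockCoef eb v u).eval m = L.blockCoef (v.eval m) (u.eval m) := by
  simp only [blockCoef, eval_ifEq, eval_offset h, eval_levels h, eval_add, eval_sub, eval_mul,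
    eval_ofNat, eval_mod, eval_eqInd_eq_kron, eval_start h, eval_block h, eval_left h,
    eval_right h, Layout.blockCoef]

theorem eval_blockConst : (blockConst eb v).eval m = L.blockConst (v.eval m) := by
  simp only [blockConst, eval_ifEq, eval_offset h, eval_levels h, eval_add, eval_mul,
    eval_ofNat, eval_mod, Layout.blockConst]

theorem eval_player : (player v).eval m = L.player (v.eval m) := by
  simp [player, eval_strategies h, Layout.player]

theorem eval_coef : (coef eb v u).eval m = L.coef (v.eval m) (u.eval m) := by
  simp only [coef, eval_ifEq, eval_ifLt, eval_sub, eval_ofNat, eval_eqInd_eq_kron, eval_base h,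
    eval_player h, eval_blockCoef h, Layout.coef]

theorem eval_const : (const eb v).eval m = L.const (v.eval m) := by
  simp only [const, eval_ifEq, eval_ifLt, eval_ofNat, eval_base h, eval_blockConst h, Layout.const]

theorem eval_pair : (pair eb u).eval m = L.pair (u.eval m) := by
  simp [pair, eval_base h, eval_players h, eval_width h, Layout.pair]

theorem eval_hit : (hit eb v u).eval m = L.hit (v.eval m) (u.eval m) := by
  simp only [hit, eval_ifLt, eval_sub, eval_mul, eval_div, eval_mod, eval_ofNat,
    eval_eqInd_eq_kron, eval_base h, eval_players h, eval_width h, eval_pair h, eval_profiles h,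
    eval_player h, eval_digit h, eval_strategies h, Layout.hit]

theorem eval_factor :
    (factor eb v u).eval m = L.factor (fun h => m 0 (4 + 2 * h)) (v.eval m) (u.eval m) := by
  simp only [factor, eval_ifEq, eval_hit h, eval_ofNat, eval_get, eval_add, eval_mul, eval_pair h,
    Layout.factor]

theorem eval_entryNum : (entryNum eb eE v u).eval m =
    L.entryNum (fun h => m 0 (3 + 2 * h)) (fun h => m 0 (4 + 2 * h)) (2048 * E * L.size ^ 2)
      (v.eval m) (u.eval m) := by
  simp only [entryNum, eval_coef h, eval_scale h, eval_const h, eval_factor h, eval_hit h,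
    eval_ofNat, eval_get, eval_add, eval_mul, eval_pair h, Layout.entryNum]

theorem eval_entryDen : (entryDen eb eE v u).eval m =
    L.entryDen (fun h => m 0 (4 + 2 * h)) (2048 * E * L.size ^ 2) (v.eval m) (u.eval m) := by
  simp only [entryDen, eval_scale h, eval_factor h, eval_ofNat, eval_mul, Layout.entryDen]

theorem eval_codeNum : (codeNum eb eE t).eval m =
    L.codeNum (fun h => m 0 (3 + 2 * h)) (fun h => m 0 (4 + 2 * h)) (2048 * E * L.size ^ 2)
      (t.eval m) := by
  simp only [codeNum, eval_ifLt, eval_size h, eval_mul, eval_mod, eval_div, eval_sub,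
    eval_eqInd_eq_kron, eval_entryNum h, Layout.codeNum]

theorem eval_codeDen : (codeDen eb eE t).eval m =
    L.codeDen (fun h => m 0 (4 + 2 * h)) (2048 * E * L.size ^ 2) (t.eval m) := by
  simp only [codeDen, eval_ifLt, eval_size h, eval_mul, eval_mod, eval_div, eval_sub, eval_ofNat,
    eval_entryDen h, Layout.codeDen]

theorem eval_outputEntry : (outputEntry eb eE t).eval m =
    L.outputEntry (fun h => m 0 (3 + 2 * h)) (fun h => m 0 (4 + 2 * h)) (2048 * E * L.size ^ 2)
      (t.eval m) := by
  simp only [outputEntry, eval_ifEq, eval_ifLt, eval_size h, eval_mul, eval_mod, eval_div,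
    eval_sub, eval_add, eval_ofNat, eval_codeNum h, eval_codeDen h, eval_players h,
    Layout.outputEntry]

theorem eval_outputLength : (outputLength eb).eval m = L.outputLength := by
  simp [outputLength, eval_size h, eval_players h, eval_strategies h, Layout.outputLength]

end eval

end Expr

end RAM

/-! ### Encodings as lists indexed by ranges -/

theorem flatMap_finRange {α : Type*} {k : ℕ} {f : Fin k → List α} {g : ℕ → List α}
    (h : ∀ i : Fin k, f i = g i) : (List.finRange k).flatMap f = (List.range k).flatMap g := by
  rw [← List.map_coe_finRange_eq_range, List.flatMap_map]
  exact List.flatMap_congr fun i _ => h i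

theorem map_range_mul {α : Type*} (F : ℕ → α) (a b : ℕ) :
    (List.range (a * b)).map F =
      (List.range a).flatMap fun i => (List.range b).map fun j => F (i * b + j) := by
  induction a with
  | zero => simp
  | succ a ih =>
    rw [Nat.succ_mul, List.range_add, List.map_append, ih, List.range_succ, List.flatMap_append,
      List.map_map]
    simp [Function.comp_def]

/-- Flattens the nested enumeration to a single range, as a loop produces it: even positions carry
numerators, odd ones denominators. -/
theorem payoffCode_eq {k n : ℕ} {num den : Fin k → (Fin k → Fin n) → ℕ} {a b : ℕ → ℕ}
    (ha : ∀ (i : Fin k) (t : Fin (n ^ k)), num i (finFunctionFinEquiv.symm t) = a (i * n ^ k + t))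
    (hb : ∀ (i : Fin k) (t : Fin (n ^ k)), den i (finFunctionFinEquiv.symm t) = b (i * n ^ k + t)) :
    payoffCode num den = k :: n :: (List.range (k * n ^ k * 2)).map
      (fun c => if c % 2 = 0 then a (c / 2) else b (c / 2)) := by
  rw [payoffCode, map_range_mul]
  congr 2
  have h2 : ∀ h : ℕ, (List.range 2).map (fun j => if (h * 2 + j) % 2 = 0 then a ((h * 2 + j) / 2)
      else b ((h * 2 + j) / 2)) = [a h, b h] := by
    intro h
    have h3 : (h * 2 + 1) / 2 = h := by omega
    simp [List.range_succ, h3]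
  simp only [h2]
  have h3 : (List.range (k * n ^ k)).flatMap (fun h => [a h, b h]) = (List.range k).flatMap
      fun i => (List.range (n ^ k)).flatMap fun t => [a (i * n ^ k + t), b (i * n ^ k + t)] := by
    have := congrArg List.flatten (map_range_mul (fun h => [a h, b h]) k (n ^ k))
    simpa [List.flatMap_def, List.flatten_flatten, Function.comp_def] using this
  rw [h3]
  refine flatMap_finRange fun i => flatMap_finRange fun t => ?_
  rw [ha, hb]

namespace Layout

variable (L : Layout) (A B : ℕ → ℕ) (D : ℕ)

theorem mapping_code : L.mapping.code =
    (List.range (L.k + L.k * L.n)).map (fun y => if y < L.k then 0 else 2 + (y - L.k)) := by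
  rw [List.range_add, List.map_append, GameMapping.code]
  congr 1
  · rw [← List.map_coe_finRange_eq_range, List.map_map]
    refine List.map_congr_left fun i _ => ?_
    simp [mapping]
  · rw [List.map_map, map_range_mul]
    refine flatMap_finRange fun i => ?_
    rw [← List.map_coe_finRange_eq_range, List.map_map]
    refine List.map_congr_left fun j _ => ?_
    simp [mapping]
    ring

theorem map_outputEntry :
    (List.range L.outputLength).map (L.outputEntry A B D) =
      (2 :: L.size :: (List.range (2 * L.size ^ 2 * 2)).map
        (fun c => if c % 2 = 0 then L.codeNum A B D (c / 2) else L.codeDen B D (c / 2))) ++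
      L.mapping.code := by
  rw [outputLength, List.range_add, List.range_add, mapping_code]
  simp only [List.map_append, List.map_map, ← List.append_assoc]
  congr 1
  · have h2 : List.range 2 = [0, 1] := rfl
    rw [h2]
    have h3 : List.map (L.outputEntry A B D) [0, 1] = [2, L.size] := by
      simp [outputEntry]
    rw [h3, sq]
    change _ = [2, L.size] ++ _
    congr 1
    refine List.map_congr_left fun c hc => ?_
    rw [List.mem_range] at hc
    simp only [Function.comp_apply, outputEntry]
    rw [if_neg (by omega), if_neg (by omega), show 2 + c - 2 = c by omega, if_pos hc]
  · refine List.map_congr_left fun y _ => ?_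
    simp only [Function.comp_apply, outputEntry]
    rw [if_neg (by omega), if_neg (by omega), if_neg (by omega)]
    rw [show 2 + (2 * (L.size * L.size) * 2 + y) - 2 - 2 * (L.size * L.size) * 2 = y by omega]

theorem game_isCode {A B : ℕ → ℕ} {D : ℕ} (hk : 0 < L.k)
    (hA : ∀ h < L.k * L.profiles, A h ≤ B h) (hD : 2 ≤ D)
    (hB : ∀ h < L.k * L.profiles, 0 < B h) :
    (L.game A B D hk hA hD).IsCode (2 :: L.size :: (List.range (2 * L.size ^ 2 * 2)).map
        (fun c => if c % 2 = 0 then L.codeNum A B D (c / 2) else L.codeDen B D (c / 2))) := by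
  have hs := L.size_pos
  refine ⟨fun i s => if i = 0 then (if s 0 = s 1 then 1 else 0) else L.entryNum A B D (s 1) (s 0),
    fun i s => if i = 0 then 1 else L.entryDen B D (s 1) (s 0), ?_, ?_⟩
  · intro i s
    dsimp only
    constructor
    · split_ifs
      · exact one_pos
      · exact Nat.mul_pos (by omega) (factor_pos hk hB (s 0).2)
    · by_cases hi : i = 0
      · simp [game, hi]
      · simp [game, hi]
  · have h0 : ∀ t : Fin (L.size ^ 2), ((finFunctionFinEquiv.symm t 0 : Fin L.size) : ℕ) =
        t % L.size := fun t => by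
      rw [finFunctionFinEquiv_symm_apply_val]; simp
    have h1 : ∀ t : Fin (L.size ^ 2), ((finFunctionFinEquiv.symm t 1 : Fin L.size) : ℕ) =
        t / L.size := fun t => by
      rw [finFunctionFinEquiv_symm_apply_val]
      have := t.2
      simp only [Fin.val_one, pow_one]
      rw [Nat.mod_eq_of_lt]
      rw [Nat.div_lt_iff_lt_mul hs, ← sq]
      exact this
    refine (payoffCode_eq ?_ ?_).symm
    · intro i t
      have ht : (t : ℕ) < L.size * L.size := t.2.trans_eq (sq _)
      have hsq : L.size ^ 2 = L.size * L.size := sq _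
      fin_cases i
      · simp only [Fin.zero_eta, if_true, zero_mul, zero_add, codeNum]
        rw [if_pos ht, kron]
        by_cases h : finFunctionFinEquiv.symm t 0 = finFunctionFinEquiv.symm t 1
        · rw [if_pos h, if_pos (by rw [← h0, ← h1, h])]
        · rw [if_neg h, if_neg (by rw [← h0, ← h1]; exact fun h' => h (Fin.ext h'))]
      · simp only [Fin.mk_one, one_ne_zero, if_false, one_mul, codeNum, h0, h1]
        rw [if_neg (by omega), show L.size ^ 2 + (t : ℕ) - L.size * L.size = t by omega]
    · intro i t
      have ht : (t : ℕ) < L.size * L.size := t.2.trans_eq (sq _)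
      have hsq : L.size ^ 2 = L.size * L.size := sq _
      fin_cases i
      · simp only [Fin.zero_eta, if_true, zero_mul, zero_add, codeDen]
        rw [if_pos ht]
      · simp only [Fin.mk_one, one_ne_zero, if_false, one_mul, codeDen, h0, h1]
        rw [if_neg (by omega), show L.size ^ 2 + (t : ℕ) - L.size * L.size = t by omega]

end Layout

/-! ### Memory states and execution of the program -/

namespace RAM

theorem length_le_inputSize (w : List ℕ) : w.length ≤ inputSize w := by
  induction w with
  | nil => simp
  | cons x w ih => simp only [inputSize, List.map_cons, List.sum_cons, List.length_cons] at *; omega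

theorem size_le_inputSize {w : List ℕ} {x : ℕ} (hx : x ∈ w) : x.size ≤ inputSize w := by
  have : x.size + 1 ≤ inputSize w :=
    List.single_le_sum (by simp) _ (List.mem_map.2 ⟨x, hx, rfl⟩)
  omega

/-- Memory with input `inp`, tables `t₃` and `t₄`, output `out` and loop counter `c`. -/
def state (inp t₃ t₄ out : ℕ → ℕ) (c : ℕ) : Mem
  | 0 => inp
  | 1 => out
  | 2 => fun i => if i = 0 then c else 0
  | 3 => t₃
  | 4 => t₄
  | _ + 5 => fun _ => 0

/-- The first entries of a table. -/
def table (f : ℕ → ℕ) (b j : ℕ) : ℕ := if j ≤ b then f j else 0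

/-- The first entries of the output. -/
def outputTable (f : ℕ → ℕ) (b j : ℕ) : ℕ := if j = 0 then 0 else if j ≤ b then f (j - 1) else 0

section state

variable (inp t₃ t₄ out : ℕ → ℕ) (c v : ℕ)

theorem inputMem_eq_state (w : List ℕ) :
    inputMem w = state (inputMem w 0) (fun _ => 0) (fun _ => 0) (fun _ => 0) 0 := by
  funext a i
  rcases a with _ | _ | _ | _ | _ | a <;> simp [state, inputMem]

theorem write_counter : (state inp t₃ t₄ out c).write 2 0 v = state inp t₃ t₄ out v := by
  funext a i
  rcases a with _ | _ | _ | _ | _ | a <;> simp [state, Mem.write, Function.update_apply]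
  split_ifs <;> rfl

theorem write_output (i : ℕ) :
    (state inp t₃ t₄ out c).write 1 i v = state inp t₃ t₄ (Function.update out i v) c := by
  funext a i
  rcases a with _ | _ | _ | _ | _ | a <;> simp [state, Mem.write]

theorem write_three (i : ℕ) :
    (state inp t₃ t₄ out c).write 3 i v = state inp (Function.update t₃ i v) t₄ out c := by
  funext a i
  rcases a with _ | _ | _ | _ | _ | a <;> simp [state, Mem.write]

theorem write_four (i : ℕ) :
    (state inp t₃ t₄ out c).write 4 i v = state inp t₃ (Function.update t₄ i v) out c := by
  funext a i
  rcases a with _ | _ | _ | _ | _ | a <;> simp [state, Mem.write]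

theorem state_bounded {B : ℕ} (h₀ : ∀ i, (inp i).size ≤ B) (hc : c.size ≤ B)
    (h₃ : ∀ i, (t₃ i).size ≤ B) (h₄ : ∀ i, (t₄ i).size ≤ B) :
    (state inp t₃ t₄ out c).Bounded B := by
  intro a ha i
  rcases a with _ | _ | _ | _ | _ | a
  · exact h₀ i
  · exact absurd rfl ha
  · simp only [state]
    split_ifs
    · exact hc
    · simp
  · exact h₃ i
  · exact h₄ i
  · simp [state]

end state

theorem update_table (f : ℕ → ℕ) (b : ℕ) :
    Function.update (table f b) (b + 1) (f (b + 1)) = table f (b + 1) := by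
  funext j
  simp only [Function.update_apply, table]
  split_ifs with h <;> first | omega | rfl | rw [h]

theorem update_table_zero (f : ℕ → ℕ) :
    Function.update (fun _ => 0) 0 (f 0) = table f 0 := by
  funext j
  simp only [Function.update_apply, table]
  split_ifs with h <;> first | omega | rfl | rw [h]

theorem update_outputTable (f : ℕ → ℕ) (b : ℕ) :
    Function.update (outputTable f b) (b + 1) (f b) = outputTable f (b + 1) := by
  funext j
  simp only [Function.update_apply, outputTable]
  split_ifs with h <;> first | omega | rfl | (rw [h, Nat.add_sub_cancel])

theorem output_state (inp t₃ t₄ f : ℕ → ℕ) (c b : ℕ) :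
    (state inp t₃ t₄ (Function.update (outputTable f b) 0 b) c).output = (List.range b).map f := by
  unfold Mem.output
  simp only [state, Function.update_self]
  refine List.map_congr_left fun i hi => ?_
  rw [List.mem_range] at hi
  rw [Function.update_of_ne (Nat.succ_ne_zero i), outputTable, if_neg (Nat.succ_ne_zero i),
    if_pos (by omega)]
  rfl

open RAM.Expr in
/-- The program for the reduction. -/
def reduction (eb eE : Expr) : Prog :=
  .seq (.set 3 0 1) <|
  .seq (forLoop players 3 (counter + 1) (get 3 counter * strategies)) <|
  .seq (.set 2 0 0) <|
  .seq (.set 4 0 1) <|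
  .seq (forLoop eb 4 (counter + 1) (get 4 counter * 2)) <|
  .seq (.set 2 0 0) <|
  .seq (forLoop (outputLength eb) 1 (counter + 1) (outputEntry eb eE counter)) <|
  .set 1 0 (outputLength eb)

theorem eval_counter (inp t₃ t₄ out : ℕ → ℕ) (c : ℕ) :
    counter.eval (state inp t₃ t₄ out c) = c := by
  simp [counter, Expr.eval, state]

theorem avoids_counter : counter.AvoidsOutput := by simp [counter, Expr.AvoidsOutput]

-- At most `B` rounds of linear cost in each of the three loops give the quadratic bound. The
-- hypothesis on `eE` concerns only the completed tables, so that expression may read the powers of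
-- two.
open RAM.Expr in
theorem exists_time_reduction_le (eb eE : Expr) (hb : eb.AvoidsOutput) (hE : eE.AvoidsOutput) :
    ∃ C : ℕ, ∀ (inp : ℕ → ℕ) (L : Layout) (b E B : ℕ), inp 1 = L.k → inp 2 = L.n →
      (∀ t₃ t₄ out c, eb.eval (state inp t₃ t₄ out c) = b) →
      (∀ out c, eE.eval (state inp L.pow (table (2 ^ ·) b) out c) = E) →
      b + L.k * L.profiles + 5 = L.R →
      (∀ i, (inp i).size ≤ B) → (∀ j ≤ L.k, (L.n ^ j).size ≤ B) → b + 1 ≤ B →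
      L.outputLength ≤ B →
      ∃ t ≤ C * (B + 1) ^ 2, Exec (reduction eb eE)
        (state inp (fun _ => 0) (fun _ => 0) (fun _ => 0) 0)
        (state inp L.pow (table (2 ^ ·) b) (Function.update (outputTable (L.outputEntry
          (fun h => inp (3 + 2 * h)) (fun h => inp (4 + 2 * h)) (2048 * E * L.size ^ 2))
            L.outputLength) 0 L.outputLength) L.outputLength) t := by
  have hc1 : (counter + 1).AvoidsOutput := by simp [avoids_counter]
  obtain ⟨C₁, h₁⟩ := exists_time_set_le 3 0 1 (by simp) (by simp)
  obtain ⟨C₂, h₂⟩ := exists_time_forLoop_le players 3 (counter + 1)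
    (get 3 counter * strategies) (by simp) hc1 (by simp [avoids_counter]) (by norm_num)
  obtain ⟨C₃, h₃⟩ := exists_time_set_le 2 0 0 (by simp) (by simp)
  obtain ⟨C₄, h₄⟩ := exists_time_set_le 4 0 1 (by simp) (by simp)
  obtain ⟨C₅, h₅⟩ := exists_time_forLoop_le eb 4 (counter + 1)
    (get 4 counter * 2) hb hc1 (by simp [avoids_counter]) (by norm_num)
  obtain ⟨C₆, h₆⟩ := exists_time_forLoop_le (outputLength eb) 1 (counter + 1)
    (outputEntry eb eE counter) (avoids_outputLength hb) hc1
    (avoids_outputEntry hb hE avoids_counter) (by norm_num)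
  obtain ⟨C₇, h₇⟩ := exists_time_set_le 1 0 (outputLength eb) (by simp) (avoids_outputLength hb)
  refine ⟨C₁ + C₂ + C₃ + C₄ + C₅ + C₃ + C₆ + C₇ + 7, ?_⟩
  intro inp L b E B hk hn hbv hEv hR hinp hpow hbB hlen
  have hkB : L.k ≤ B := by
    have : L.k ≤ L.outputLength := by unfold Layout.outputLength; omega
    omega
  have hpowtab : table (L.n ^ ·) L.k = L.pow := by
    funext j; simp only [table, Layout.pow]
  have hone : (1 : ℕ).size ≤ B := by rw [Nat.size_one]; omega
  have hzero : ∀ i : ℕ, ((fun _ => 0 : ℕ → ℕ) i).size ≤ B := fun i => by simp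
  have hcount : ∀ c ≤ B, c.size ≤ B := fun c hc => (size_le_self c).trans hc
  have htab₃ : ∀ i ≤ L.k, ∀ j, (table (L.n ^ ·) i j).size ≤ B := by
    intro i hi j
    unfold table
    split_ifs
    · exact hpow j (by omega)
    · simp
  have htab₄ : ∀ i ≤ b, ∀ j, (table (2 ^ ·) i j).size ≤ B := by
    intro i hi j
    unfold table
    split_ifs
    · rw [Nat.size_pow]; omega
    · simp
  have hpl : ∀ t₃ t₄ out c, players.eval (state inp t₃ t₄ out c) = L.k := fun t₃ t₄ out c => by
    simpa [players, state] using hk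
  have hst : ∀ t₃ t₄ out c, strategies.eval (state inp t₃ t₄ out c) = L.n :=
    fun t₃ t₄ out c => by simpa [strategies, state] using hn
  obtain ⟨s₁, hs₁, e₁⟩ := h₁ _ B (state_bounded inp (fun _ => 0) (fun _ => 0) (fun _ => 0) 0 hinp
    (by simp) hzero hzero)
  rw [eval_ofNat, eval_ofNat, write_three,
    show Function.update (fun _ => 0) 0 1 = table (L.n ^ ·) 0 from
      update_table_zero (L.n ^ ·)] at e₁
  obtain ⟨s₂, hs₂, e₂⟩ := h₂
    (fun i => state inp (table (L.n ^ ·) i) (fun _ => 0) (fun _ => 0) i) L.k B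
    (fun i hi => state_bounded _ _ _ _ _ hinp (hcount i (by omega)) (htab₃ i hi) hzero)
    (fun i hi => hpl _ _ _ _) (fun i hi => by simp [state])
    (fun i hi => by
      rw [eval_add, eval_ofNat, eval_counter, eval_mul, eval_get, eval_counter, hst, write_three,
        write_counter]
      congr 1
      have : state inp (table (L.n ^ ·) i) (fun _ => 0) (fun _ => 0) i 3 i * L.n =
          L.n ^ (i + 1) := by
        simp [state, table, pow_succ]
      rw [this]
      exact update_table (L.n ^ ·) i)
  rw [hpowtab] at e₂
  have hpowB : ∀ j, (L.pow j).size ≤ B := by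
    rw [← hpowtab]; exact htab₃ L.k le_rfl
  obtain ⟨s₃, hs₃, e₃⟩ := h₃ _ B (state_bounded inp L.pow (fun _ => 0) (fun _ => 0) L.k hinp
    (hcount _ hkB) hpowB hzero)
  rw [eval_ofNat, write_counter] at e₃
  obtain ⟨s₄, hs₄, e₄⟩ := h₄ _ B (state_bounded inp L.pow (fun _ => 0) (fun _ => 0) 0 hinp
    (by simp) hpowB hzero)
  rw [eval_ofNat, eval_ofNat, write_four,
    show Function.update (fun _ => 0) 0 1 = table (2 ^ ·) 0 from
      update_table_zero (2 ^ ·)] at e₄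
  obtain ⟨s₅, hs₅, e₅⟩ := h₅
    (fun i => state inp L.pow (table (2 ^ ·) i) (fun _ => 0) i) b B
    (fun i hi => state_bounded _ _ _ _ _ hinp (hcount i (by omega)) hpowB (htab₄ i hi))
    (fun i hi => hbv _ _ _ _) (fun i hi => by simp [state])
    (fun i hi => by
      rw [eval_add, eval_ofNat, eval_counter, eval_mul, eval_get, eval_counter, eval_ofNat,
        write_four, write_counter]
      congr 1
      have : state inp L.pow (table (2 ^ ·) i) (fun _ => 0) i 4 i * 2 = 2 ^ (i + 1) := by
        simp [state, table, pow_succ]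
      rw [this]
      exact update_table (2 ^ ·) i)
  obtain ⟨s₆, hs₆, e₆⟩ := h₃ _ B (state_bounded inp L.pow (table (2 ^ ·) b) (fun _ => 0) b hinp
    (hcount _ (by omega)) hpowB (htab₄ b le_rfl))
  rw [eval_ofNat, write_counter] at e₆
  have hholds : ∀ out c, Holds eb eE (state inp L.pow (table (2 ^ ·) b) out c) L E :=
    fun out c => ⟨hk, hn, rfl, by rw [hbv, hR], hEv out c⟩
  set F := L.outputEntry (fun h => inp (3 + 2 * h)) (fun h => inp (4 + 2 * h))
    (2048 * E * L.size ^ 2) with hF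
  -- Entry `i` goes to cell `i + 1`; cell `0` stays zero until the length is written at the very
  -- end.
  obtain ⟨s₇, hs₇, e₇⟩ := h₆
    (fun i => state inp L.pow (table (2 ^ ·) b) (outputTable F i) i) L.outputLength B
    (fun i hi => state_bounded _ _ _ _ _ hinp (hcount i (by omega)) hpowB (htab₄ b le_rfl))
    (fun i hi => eval_outputLength (hholds _ _)) (fun i hi => by simp [state])
    (fun i hi => by
      rw [eval_add, eval_ofNat, eval_counter, eval_outputEntry (hholds _ _), eval_counter,
        write_output, write_counter]
      congr 1
      exact update_outputTable F i)
  have hout0 : outputTable F 0 = fun _ => 0 := by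
    funext j; simp only [outputTable]; split_ifs <;> first | rfl | omega
  rw [hout0] at e₇
  obtain ⟨s₈, hs₈, e₈⟩ := h₇ _ B (state_bounded inp L.pow (table (2 ^ ·) b)
    (outputTable F L.outputLength) L.outputLength hinp (hcount _ hlen) hpowB (htab₄ b le_rfl))
  rw [eval_ofNat, eval_outputLength (hholds _ _), write_output] at e₈
  refine ⟨_, ?_, .seq e₁ (.seq e₂ (.seq e₃ (.seq e₄ (.seq e₅ (.seq e₆ (.seq e₇ e₈))))))⟩
  have hloop : ∀ C b' : ℕ, b' ≤ B → C * (B + 1) * (b' + 1) ≤ C * (B + 1) ^ 2 := by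
    intro C b' hb'
    rw [sq, ← mul_assoc]
    exact Nat.mul_le_mul_left _ (by omega)
  have hset : ∀ C : ℕ, C * (B + 1) ≤ C * (B + 1) ^ 2 := fun C =>
    Nat.mul_le_mul_left _ (Nat.le_self_pow two_ne_zero _)
  have := hs₁.trans (hset C₁)
  have := hs₂.trans (hloop C₂ L.k hkB)
  have := hs₃.trans (hset C₃)
  have := hs₄.trans (hset C₄)
  have := hs₅.trans (hloop C₅ b (by omega))
  have := hs₆.trans (hset C₃)
  have := hs₇.trans (hloop C₆ _ hlen)
  have := hs₈.trans (hset C₇)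
  have : 7 ≤ 7 * (B + 1) ^ 2 := by
    have : 1 ≤ (B + 1) ^ 2 := Nat.one_le_pow _ _ (by omega)
    omega
  simp only [add_mul]
  omega

end RAM

/-! ### The reduction -/

theorem exists_index_function {k n : ℕ} (num : Fin k → (Fin k → Fin n) → ℕ) :
    ∃ a : ℕ → ℕ, ∀ (i : Fin k) (t : Fin (n ^ k)),
      num i (finFunctionFinEquiv.symm t) = a (i * n ^ k + t) := by
  refine ⟨fun h => if hh : h / n ^ k < k ∧ h % n ^ k < n ^ k then
    num ⟨_, hh.1⟩ (finFunctionFinEquiv.symm ⟨_, hh.2⟩) else 0, fun i t => ?_⟩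
  have hN : 0 < n ^ k := t.pos
  have h1 : ((i : ℕ) * n ^ k + t) / n ^ k = i := by
    rw [add_comm, Nat.add_mul_div_right _ _ hN, Nat.div_eq_of_lt t.2, zero_add]
  have h2 : ((i : ℕ) * n ^ k + t) % n ^ k = t := by
    rw [add_comm, Nat.add_mul_mod_self_right, Nat.mod_eq_of_lt t.2]
  simp [h1, h2]

theorem exists_eq_mul_add {k N h : ℕ} (hh : h < k * N) :
    ∃ (i : Fin k) (t : Fin N), h = i * N + t := by
  have hN : 0 < N := Nat.pos_of_mul_pos_left (by omega : 0 < k * N)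
  refine ⟨⟨h / N, by rwa [Nat.div_lt_iff_lt_mul hN]⟩, ⟨h % N, Nat.mod_lt _ hN⟩, ?_⟩
  have := Nat.mod_add_div h N
  rw [mul_comm] at this
  simp only
  omega

namespace RAM

theorem inputMem_payoffCode {k n : ℕ} {num den : Fin k → (Fin k → Fin n) → ℕ} (i : Fin k)
    (t : Fin (n ^ k)) :
    inputMem (payoffCode num den) 0 (3 + 2 * (i * n ^ k + t)) =
        num i (finFunctionFinEquiv.symm t) ∧
      inputMem (payoffCode num den) 0 (4 + 2 * (i * n ^ k + t)) =
        den i (finFunctionFinEquiv.symm t) := by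
  obtain ⟨a, ha⟩ := exists_index_function num
  obtain ⟨b, hb⟩ := exists_index_function den
  have hlt : (i : ℕ) * n ^ k + t < k * n ^ k := by
    have := Nat.mul_le_mul_right (n ^ k) i.2
    have := t.2
    rw [Nat.succ_mul] at *
    omega
  rw [ha, hb, payoffCode_eq ha hb]
  set h := (i : ℕ) * n ^ k + t
  constructor
  -- Cell `0` holds the length and cells `1`, `2` hold `k`, `n`, so the fractions start at cell `3`.
  · rw [show 3 + 2 * h = (2 * h + 1 + 1) + 1 by ring]
    simp only [inputMem, List.getD_cons_succ]
    rw [List.getD_eq_getElem _ _ (by simp; omega)]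
    simp
  · rw [show 4 + 2 * h = (2 * h + 1 + 1 + 1) + 1 by ring]
    simp only [inputMem, List.getD_cons_succ]
    rw [List.getD_eq_getElem _ _ (by simp; omega)]
    simp only [List.getElem_map, List.getElem_range]
    rw [if_neg (by omega), show (2 * h + 1) / 2 = h by omega]

theorem length_payoffCode {k n : ℕ} (num den : Fin k → (Fin k → Fin n) → ℕ) :
    (payoffCode num den).length = k * n ^ k * 2 + 2 := by
  obtain ⟨a, ha⟩ := exists_index_function num
  obtain ⟨b, hb⟩ := exists_index_function den
  simp [payoffCode_eq ha hb]

theorem size_inputMem_le (w : List ℕ) (i : ℕ) : (inputMem w 0 i).size ≤ inputSize w := by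
  rcases i with _ | i
  · exact (size_le_self _).trans (length_le_inputSize w)
  · simp only [inputMem]
    by_cases hi : i < w.length
    · rw [List.getD_eq_getElem _ _ hi]
      exact size_le_inputSize (List.getElem_mem hi)
    · rw [List.getD_eq_default _ _ (by omega)]
      simp

end RAM

/-! ### Polynomial bounds and choice of parameters -/

open Polynomial in
/-- A polynomial bound for the number of strategies of the new game. -/
noncomputable def sizeBound (p : ℕ[X]) : ℕ[X] := 2 + X + X * X * (6 * (p + X + 5) + 2)

open Polynomial in
/-- A polynomial bound for the memory cells and the loops of the program. -/
noncomputable def memoryBound (p : ℕ[X]) : ℕ[X] :=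
  X + p + 1 + (2 + (2 * (sizeBound p * sizeBound p) * 2 + (X + X)))

theorem Polynomial.eval_mono_nat (p : Polynomial ℕ) {a b : ℕ} (h : a ≤ b) :
    p.eval a ≤ p.eval b := by
  rw [Polynomial.eval_eq_sum, Polynomial.eval_eq_sum]
  exact Finset.sum_le_sum fun i _ => Nat.mul_le_mul_left _ (Nat.pow_le_pow_left h i)

/-- The input lists `k * n ^ k` fractions, so `k`, `n` and `k * n ^ k` are all at most the input
size `s`, and all layout parameters are polynomial in `s`. -/
theorem outputLength_le (p : Polynomial ℕ) {k n s : ℕ} (hk : 1 ≤ k) (hn : 1 ≤ n)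
    (hs : k * n ^ k * 2 + 2 ≤ s) :
    p.eval n + 1 + Layout.outputLength ⟨k, n, p.eval n + k * n ^ k + 5⟩ ≤
      (memoryBound p).eval s := by
  have hN : 1 ≤ n ^ k := Nat.one_le_pow _ _ hn
  have hkN : k * n ^ k ≤ s := by omega
  have hks : k ≤ s := le_trans (Nat.le_mul_of_pos_right _ hN) hkN
  have hnN : n ≤ n ^ k := Nat.le_self_pow (by omega) n
  have hkn : k * n ≤ s := (Nat.mul_le_mul_left _ hnN).trans hkN
  have hns : n ≤ s := le_trans (Nat.le_mul_of_pos_left _ hk) hkn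
  have hp := p.eval_mono_nat hns
  have hsize : Layout.size ⟨k, n, p.eval n + k * n ^ k + 5⟩ ≤ (sizeBound p).eval s := by
    have h1 : k * n ^ k * k ≤ s * s := Nat.mul_le_mul hkN hks
    have h2 : 6 * (p.eval n + k * n ^ k + 5) + 2 ≤ 6 * (p.eval s + s + 5) + 2 := by omega
    have h3 := Nat.mul_le_mul h1 h2
    simp only [sizeBound, Layout.size, Layout.base, Layout.width, Layout.profiles,
      Polynomial.eval_add, Polynomial.eval_mul, Polynomial.eval_X, Polynomial.eval_ofNat]
    omega
  have h4 := Nat.mul_le_mul hsize hsize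
  simp only [memoryBound, Layout.outputLength, Polynomial.eval_add, Polynomial.eval_mul,
    Polynomial.eval_X, Polynomial.eval_ofNat, Polynomial.eval_one]
  omega

open RAM in
/-- A direct, polynomial-time reduction for an error of the form `1 / f (p n)`, where `g` turns an
expression for `p n` into one for `f (p n)`. -/
theorem directPolyTimeReduction_of_le {p : Polynomial ℕ} {f : ℕ → ℕ} {e₁ e₂ : ℕ → ℝ}
    {g : Expr → Expr} (hg : ∀ e, e.AvoidsOutput → (g e).AvoidsOutput)
    (hgf : ∀ e inp t₃ b out c, e.eval (state inp t₃ (table (2 ^ ·) b) out c) = b →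
      (g e).eval (state inp t₃ (table (2 ^ ·) b) out c) = f b)
    (hf : ∀ b, f b ≤ 2 ^ b) (hfpos : ∀ n, 1 ≤ n → 0 < f (p.eval n))
    (h₁ : ∀ n, 1 ≤ n → 1 / (f (p.eval n) : ℝ) ≤ e₁ n)
    (h₂ : ∀ n n₂, 1 ≤ n → n ≤ n₂ →
      0 ≤ e₂ n₂ ∧ e₂ n₂ ≤ 1 / (2 ^ 30 * (f (p.eval n) : ℝ) ^ 3 * (n₂ : ℝ) ^ 4)) :
    DirectPolyTimeReduction e₁ e₂ := by
  obtain ⟨eb, hb, hbv⟩ := Expr.exists_eval_eq_polynomial Expr.strategies p (by simp)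
  obtain ⟨C, hC⟩ := exists_time_reduction_le eb (g eb) hb (hg eb hb)
  refine ⟨reduction eb (g eb), Polynomial.C C * (memoryBound p + 1) ^ 2, ?_⟩
  rintro k n hk hn G w ⟨num, den, hG, rfl⟩
  set w := payoffCode num den with hw
  set b := p.eval n with hbdef
  -- The number of levels is linear in `b` and `k * n ^ k`, yet `4 ^ (R - 1)` dominates `256 * n ^ k
  -- * k * f b` because `f b ≤ 2 ^ b`.
  let L : Layout := ⟨k, n, b + k * n ^ k + 5⟩
  set inp := inputMem w 0 with hinp
  have hlen := length_le_inputSize w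
  rw [hw, length_payoffCode, ← hw] at hlen
  have hbound := outputLength_le p hk hn hlen
  rw [← hbdef] at hbound
  have hinp1 : inp 1 = k := rfl
  have hinp2 : inp 2 = n := rfl
  have hbv' : ∀ t₃ t₄ out c, eb.eval (state inp t₃ t₄ out c) = b := fun t₃ t₄ out c => by
    rw [hbv]
    simp [Expr.strategies, state, hinp2, hbdef]
  have hN : 1 ≤ n ^ k := Nat.one_le_pow _ _ hn
  have hself : inputSize w ≤ (memoryBound p).eval (inputSize w) := by
    simp only [memoryBound, Polynomial.eval_add, Polynomial.eval_X]
    omega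
  obtain ⟨t, ht, hex⟩ := hC inp L b (f b) ((memoryBound p).eval (inputSize w)) hinp1 hinp2 hbv'
    (fun out c => hgf eb inp _ b out c (hbv' _ _ _ _)) rfl
    (fun i => (size_inputMem_le w i).trans hself)
    (fun j hj => by
      have h1 : n ^ j ≤ n ^ k := Nat.pow_le_pow_right hn hj
      have h2 : n ^ k ≤ k * n ^ k := Nat.le_mul_of_pos_left _ hk
      exact (size_le_self _).trans (by change n ^ j ≤ _; omega))
    (by omega) (by change Layout.outputLength ⟨k, n, b + k * n ^ k + 5⟩ ≤ _; omega)
  rw [hinp, ← inputMem_eq_state] at hex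
  refine ⟨_, t, hex, by simpa using ht, ?_⟩
  set A : ℕ → ℕ := fun h => inp (3 + 2 * h) with hAdef
  set B : ℕ → ℕ := fun h => inp (4 + 2 * h) with hBdef
  have hAB : ∀ (i : Fin k) (t : Fin (n ^ k)),
      A (i * n ^ k + t) = num i (finFunctionFinEquiv.symm t) ∧
      B (i * n ^ k + t) = den i (finFunctionFinEquiv.symm t) := fun i t =>
    inputMem_payoffCode i t
  have hB : ∀ h < L.k * L.profiles, 0 < B h := by
    intro h hh
    obtain ⟨i, t, rfl⟩ := exists_eq_mul_add hh
    exact (hAB i t).2 ▸ (hG i _).1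
  have hA : ∀ h < L.k * L.profiles, A h ≤ B h := by
    intro h hh
    obtain ⟨i, t, rfl⟩ := exists_eq_mul_add hh
    have h1 := G.payoff_le_one i (finFunctionFinEquiv.symm t)
    have h2 := hG i (finFunctionFinEquiv.symm t)
    rw [h2.2, div_le_one (by exact_mod_cast h2.1)] at h1
    rw [show A (i * L.profiles + t) = _ from (hAB i t).1,
      show B (i * L.profiles + t) = _ from (hAB i t).2]
    exact_mod_cast h1
  have hk' : 0 < L.k := hk
  have hE := hfpos n hn
  have hD : 2 ≤ 2048 * f b * L.size ^ 2 := by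
    have : 1 ≤ L.size ^ 2 := Nat.one_le_pow _ _ L.size_pos
    have : 1 ≤ f b * L.size ^ 2 := Nat.mul_pos hE this
    rw [mul_assoc]
    omega
  refine ⟨L.size, L.game A B _ hk' hA hD, L.mapping, _, L.game_isCode hk' hA hD hB, ?_, ?_⟩
  · rw [output_state]
    exact L.map_outputEntry A B _
  · have hnsize : n ≤ L.size := by
      change n ≤ 2 + k * n + _
      have : n ≤ k * n := Nat.le_mul_of_pos_left _ hk
      omega
    refine Layout.isDirectReduction hk' hA hD (E := f b) hn (Nat.succ_pos _) hE ?_ rfl hB ?_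
      (h₁ n hn) (h₂ n _ hn hnsize).1 (h₂ n _ hn hnsize).2
    · change 256 * (n ^ k * k) * f b ≤ 4 ^ (b + k * n ^ k + 4)
      have h3 : n ^ k * k ≤ 2 ^ (k * n ^ k) := by
        rw [mul_comm]; exact Nat.lt_two_pow_self.le
      have h4 : (2 : ℕ) ^ (k * n ^ k) ≤ 4 ^ (k * n ^ k) := Nat.pow_le_pow_left (by norm_num) _
      have h5 : (2 : ℕ) ^ b ≤ 4 ^ b := Nat.pow_le_pow_left (by norm_num) _
      calc 256 * (n ^ k * k) * f b ≤ 256 * 4 ^ (k * n ^ k) * 4 ^ b :=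
            Nat.mul_le_mul (Nat.mul_le_mul_left _ (h3.trans h4)) ((hf b).trans h5)
        _ = 4 ^ (b + k * n ^ k + 4) := by rw [pow_add, pow_add]; norm_num; ring
    · intro i t
      rw [(hG i _).2, show A (i * L.profiles + t) = _ from (hAB i t).1,
        show B (i * L.profiles + t) = _ from (hAB i t).2]
      push_cast
      rfl

/-! ### The two error regimes -/

theorem corollary2 :
    (∀ (p : Polynomial ℕ) (e : ℕ → ℝ),
      (∀ n : ℕ, 1 ≤ n → 1 / (2 : ℝ) ^ (p.eval n) ≤ e n) →
      ∃ q : Polynomial ℕ, q.natDegree ≤ max 1 p.natDegree ∧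
        DirectPolyTimeReduction e (fun n => 1 / (2 : ℝ) ^ (q.eval n))) ∧
    (∀ (p : Polynomial ℕ) (e : ℕ → ℝ),
      (∀ n : ℕ, 1 ≤ n → 0 < p.eval n ∧ 1 / ((p.eval n : ℕ) : ℝ) ≤ e n) →
      ∃ q : Polynomial ℕ, (∀ n : ℕ, 1 ≤ n → 0 < q.eval n) ∧
        DirectPolyTimeReduction e (fun n => 1 / ((q.eval n : ℕ) : ℝ))) := by
  constructor
  · intro p e he
    -- The exponent of `2 ^ 30 * E ^ 3 * n₂ ^ 4` for `E = 2 ^ p n`, using `n₂ ≤ 2 ^ n₂` and `p n ≤ p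
    -- n₂`. The linear term is why the degree may rise to `1`.
    refine ⟨Polynomial.C 3 * p + Polynomial.C 4 * Polynomial.X + Polynomial.C 30, ?_, ?_⟩
    · refine (Polynomial.natDegree_add_le _ _).trans (max_le ?_ (by simp))
      refine (Polynomial.natDegree_add_le _ _).trans (max_le ?_ ?_)
      · exact (Polynomial.natDegree_C_mul_le _ _).trans (le_max_right _ _)
      · refine (Polynomial.natDegree_C_mul_le _ _).trans ?_
        rw [Polynomial.natDegree_X]
        exact le_max_left _ _
    -- The number `2 ^ p n` is read from the table of powers of two, at its last filled index.
    · refine directPolyTimeReduction_of_le (p := p) (f := fun b => 2 ^ b)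
        (g := fun e => .get 4 e) (fun e he => by simp [he]) ?_ (fun b => le_rfl)
        (fun n _ => by positivity) (fun n hn => by simpa using he n hn) ?_
      · intro e inp t₃ b out c h
        simp [h, RAM.state, RAM.table]
      · intro n n₂ _ hn₂
        refine ⟨by positivity, one_div_le_one_div_of_le ?_ ?_⟩
        · have : (0 : ℝ) < n₂ := by exact_mod_cast (by omega : 0 < n₂)
          positivity
        · have h1 : n₂ ^ 4 ≤ (2 ^ n₂) ^ 4 := Nat.pow_le_pow_left Nat.lt_two_pow_self.le 4
          have h2 : (2 ^ p.eval n) ^ 3 ≤ (2 ^ p.eval n₂) ^ 3 :=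
            Nat.pow_le_pow_left (Nat.pow_le_pow_right (by norm_num) (p.eval_mono_nat hn₂)) 3
          have h3 : 2 ^ 30 * (2 ^ p.eval n) ^ 3 * n₂ ^ 4 ≤ 2 ^ (3 * p.eval n₂ + 4 * n₂ + 30) := by
            refine (Nat.mul_le_mul (Nat.mul_le_mul_left _ h2) h1).trans (le_of_eq ?_)
            ring
          simp only [Polynomial.eval_add, Polynomial.eval_mul, Polynomial.eval_C,
            Polynomial.eval_X]
          exact_mod_cast h3
  · intro p e he
    -- Here `E = p n` itself, so `2 ^ 30 * E ^ 3 * n₂ ^ 4` is bounded by a polynomial in `n₂`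
    -- through `p n ≤ p n₂`.
    refine ⟨Polynomial.C (2 ^ 30) * p ^ 3 * Polynomial.X ^ 4, ?_, ?_⟩
    · intro n hn
      have := (he n hn).1
      simp only [Polynomial.eval_mul, Polynomial.eval_C, Polynomial.eval_pow, Polynomial.eval_X]
      positivity
    · refine directPolyTimeReduction_of_le (p := p) (f := fun b => b) (g := fun e => e)
        (fun e he => he) ?_ (fun b => Nat.lt_two_pow_self.le) (fun n hn => (he n hn).1)
        (fun n hn => (he n hn).2) ?_
      · intro e inp t₃ b out c h
        exact h
      · intro n n₂ hn hn₂
        refine ⟨by positivity, one_div_le_one_div_of_le ?_ ?_⟩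
        · have h1 : (0 : ℝ) < n₂ := by exact_mod_cast (by omega : 0 < n₂)
          have h2 : (0 : ℝ) < p.eval n := by exact_mod_cast (he n hn).1
          positivity
        · have h1 := Nat.pow_le_pow_left (p.eval_mono_nat hn₂) 3
          have h2 : 2 ^ 30 * p.eval n ^ 3 * n₂ ^ 4 ≤ 2 ^ 30 * p.eval n₂ ^ 3 * n₂ ^ 4 :=
            Nat.mul_le_mul_right _ (Nat.mul_le_mul_left _ h1)
          simp only [Polynomial.eval_mul, Polynomial.eval_C, Polynomial.eval_pow,
            Polynomial.eval_X]
          exact_mod_cast h2
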